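/- **Setting.** Let $0<\alpha,\beta<\infty$, let $(d,X)=(2,\operatorname{curl})$ with $\operatorname{curl}v=\partial_xv_2-\partial_yv_1$, or $(d,X)=(3,\operatorname{div})$, and consider $\mathcal H(u,v)=\alpha\,(u,v)_{L^2(\Omega)}+\beta\,(Xu,Xv)_{L^2(\Omega)}$. Here $\Omega\subset\mathbb R^d$ is the union of a uniform mesh $\mathcal T_L$ of squares ($d=2$) or cubes ($d=3$) of side $h$. The mesh $\mathcal T_L$ arises by $L+1$ regular refinements (each cell is divided into $2^d$ cells) from a finite non-empty set $\mathcal M_0$ of cells of a uniform lattice. Write $\mathcal M_\ell$ for the $\ell$ times refined mesh and $\mathcal T_\ell=\mathcal M_{\ell+1}$, $0\le\ell\le L$, so that every cell $G$ of $\mathcal M_\ell$ is a macro element consisting of $2^d$ cells of $\mathcal T_\ell$. The finite element space on $\mathcal T_L$ is the lowest-order Nédélec space (if $d=2$; on each cell $P_{0,1}\times P_{1,0}$, one unknown per edge) or the lowest-order Raviart–Thomas–Nédélec space (if $d=3$; on each cell $P_{1,0,0}\times P_{0,1,0}\times P_{0,0,1}$, one unknown per face). The nodal basis function of an edge (face)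 has total tangential component (total flux) $1$ along it, in the positive coordinate direction, and $0$ along all others. Let $A^{(L)}$ be the stiffness matrix of $\mathcal H$ in this basis. **Recursive splitting.** At level $\ell=L,L-1,\dots,0$ a matrix $A^{(\ell)}$ on the edges (faces) of $\mathcal T_\ell$ is given. Change to the hierarchical basis consisting of (i) the basis functions of the edges (faces) interior to the macro elements; (ii) for each edge of $\mathcal M_\ell$, with its two halves $\phi_i,\phi_j$, the difference $\frac12(\phi_i-\phi_j)$, respectively for each face of $\mathcal M_\ell$, with its four quarters $\phi_1,\dots,\phi_4$ (ordered lexicographically), the three differences $\frac14(\phi_1-\phi_2+\phi_3-\phi_4)$, $\frac14(\phi_1+\phi_2-\phi_3-\phi_4)$, $\frac14(\phi_1-\phi_2-\phi_3+\phi_4)$; (iii) the aggregates $\frac12(\phi_i+\phi_j)$, respectively $\frac14(\phi_1+\phi_2+\phi_3+\phi_4)$. Eliminate the interior unknowns (i) exactly. The resulting Schur complement is $$B^{(\ell)}=\begin{pmatrix}B^{(\ell)}_{11}&B^{(\ell)}_{12}\\B^{(\ell)}_{21}&B^{(\ell)}_{22}\end{pmatrix},$$ with index $1$ for differences and $2$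 for aggregates; put $A^{(\ell-1)}:=B^{(\ell)}_{22}$. The CBS constant of the splitting at level $\ell$ is $$\gamma^{(\ell)}=\sup_{u,v\ne0}\frac{u^TB^{(\ell)}_{12}v}{\sqrt{u^TB^{(\ell)}_{11}u\;\,v^TB^{(\ell)}_{22}v}} .$$ Locally, let $A_K^{(L)}$ be the element matrix of $\mathcal H$ on a cell $K$ of side $h$. For a macro element $G$ assemble the $2^d$ matrices $A_K^{(\ell)}$ of its cells, apply the same transformation and static condensation to get $B_G^{(\ell)}$, let $\gamma_G^{(\ell)}$ be the CBS constant of $B_G^{(\ell)}$, and let $A_G^{(\ell-1)}:=B^{(\ell)}_{G,22}$ be the element matrix, at the next coarser level, of $G$ as a cell. **Sequences.** With $e=(\alpha/\beta)h^2$ let $a_0=2e+6$, $b_0=e-6$, $b_{k+1}=-b_k^2/a_k$, $a_{k+1}=2a_k+b_{k+1}$. **Theorem.** Put $\Theta=3/8$ if $d=2$ and $\Theta=1/2$ if $d=3$. For all $L\ge0$ and all such meshes: 1. For $k\ge0$ coarsening steps and every cell $K$, the element matrix is $$A_K^{(L-k)}=\frac{\beta}{6(2^kh)^d}\,\bigl(M_{ij}\bigr)_{i,j=1}^d,\qquad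 M_{ii}=\begin{pmatrix}a_k&b_k\\b_k&a_k\end{pmatrix},\qquad M_{ij}=\begin{pmatrix}c&-c\\-c&c\end{pmatrix}\ (i\ne j),$$ where $c=-6$ for $d=2$ and $c=6$ for $d=3$. The $i$-th pair of local unknowns belongs to the two edges parallel to (faces orthogonal to) the $i$-th axis, the one with the smaller coordinate first. 2. For $k\ge0$ and every macro element $G$, $$\bigl(\gamma_G^{(L-k)}\bigr)^2=\frac{36(a_k+b_k)}{(a_k^2-36)(a_k-b_k)}\ (d=2),\qquad \bigl(\gamma_G^{(L-k)}\bigr)^2=\frac{72(a_k+b_k)}{(a_k+12)(a_k-6)(a_k-b_k)}\ (d=3).$$ 3. At every level $0\le\ell\le L$ and for every macro element $G\in\mathcal M_\ell$, $\ \gamma^{(\ell)}\le\gamma_G^{(\ell)}<\sqrt\Theta$. 4. The constants are strictly monotone: $\gamma^{(0)}<\gamma^{(1)}<\dots<\gamma^{(L)}<\sqrt\Theta$, and likewise $\gamma_G^{(0)}<\gamma_G^{(1)}<\dots<\gamma_G^{(L)}<\sqrt\Theta$. -/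

import Mathlib

open MeasureTheory
open scoped Matrix

noncomputable section

/-! ## Model problem and lowest-order edge / face elements on a uniform mesh -/

/-- Vector fields on `ℝ^d`. -/
abbrev VField (d : ℕ) := (Fin d → ℝ) → (Fin d → ℝ)

/-- The partial derivative `∂_j u_i` at the point `x`. -/
def pderiv {d : ℕ} (u : VField d) (j i : Fin d) (x : Fin d → ℝ) : ℝ :=
  fderiv ℝ u x (Pi.single j 1) i

/-- The scalar curl `∂_x v₂ - ∂_y v₁` of a planar vector field. -/
def scalarCurl (u : VField 2) (x : Fin 2 → ℝ) : ℝ := pderiv u 0 1 x - pderiv u 1 0 x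

/-- The divergence of a vector field in space. -/
def divergence3 (u : VField 3) (x : Fin 3 → ℝ) : ℝ :=
  pderiv u 0 0 x + pderiv u 1 1 x + pderiv u 2 2 x

/-- A cell of a uniform mesh is named by the integer coordinates of its lower corner. -/
abbrev Cell (d : ℕ) := Fin d → ℤ

/-- A degree of freedom sits on a facet `(i, n)`: the edge with tangent `e_i` (Nedelec, `d = 2`),
or the face with normal `e_i` (Raviart-Thomas-Nedelec, `d = 3`), whose lower corner is the lattice
point `n`. -/
abbrev Facet (d : ℕ) := Fin d × (Fin d → ℤ)

/-- Data of a discretized model problem: the differential operator `X` (curl or div), the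
coefficients `α`, `β`, the size `h` of the cells of the finest mesh, the origin of the lattice that
carries the mesh, and, for each `i`, the coordinate axis `axis i` that is orthogonal to the facets
`(i, n)`. -/
structure Discretization (d : ℕ) where
  X : VField d → (Fin d → ℝ) → ℝ
  axis : Fin d → Fin d
  α : ℝ
  β : ℝ
  h : ℝ
  origin : Fin d → ℝ

/-- Two-dimensional `H(curl)` problem with lowest-order Nedelec elements: the edges with tangent
`e_x` are orthogonal to the `y`-axis, and conversely. -/
def nedelecCurl (α β h : ℝ) (origin : Fin 2 → ℝ) : Discretization 2 where
  X := scalarCurl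
  axis := ![1, 0]
  α := α
  β := β
  h := h
  origin := origin

/-- Three-dimensional `H(div)` problem with lowest-order Raviart-Thomas-Nedelec elements: the faces
with normal `e_i` are orthogonal to the `i`-th axis. -/
def rtnDiv (α β h : ℝ) (origin : Fin 3 → ℝ) : Discretization 3 where
  X := divergence3
  axis := id
  α := α
  β := β
  h := h
  origin := origin

/-- The hat function on `[-1, 1]`. -/
def hat (t : ℝ) : ℝ := max 0 (1 - |t|)

namespace Discretization

variable {d : ℕ} (D : Discretization d)

/-- The model form `α (u, v) + β (X u, X v)` with the `L²` inner products over `Ω`. The finite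
element fields below are piecewise polynomial with continuous tangential (normal) trace across the
element boundaries, so that their `X` is the almost everywhere defined classical one. -/
def form (Ω : Set (Fin d → ℝ)) (u v : VField d) : ℝ :=
  D.α * (∫ x in Ω, u x ⬝ᵥ v x) + D.β * (∫ x in Ω, D.X u x * D.X v x)

/-- The closed cube (square) of side `h` with name `K`. -/
def cell (K : Cell d) : Set (Fin d → ℝ) :=
  {x | ∀ j, D.origin j + D.h * K j ≤ x j ∧ x j ≤ D.origin j + D.h * (K j + 1)}

/-- The domain covered by a mesh of cells of side `h`. -/
def domain (M : Finset (Cell d)) : Set (Fin d → ℝ) := ⋃ K ∈ M, D.cell K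

/-- The nodal basis field of the facet `f = (i, n)`. It points in direction `e_i`, on each cell it
is affine in the coordinate `axis i` and constant in the others, its total tangential component
(`d = 2`) or flux (`d = 3`) along `f` is one, and along every other facet it is zero. So on
each cell it belongs to `P_{0,1} × P_{1,0}` for the Nedelec element and to
`P_{1,0,0} × P_{0,1,0} × P_{0,0,1}` for the Raviart-Thomas-Nedelec element. -/
def basisField (f : Facet d) : VField d := fun x =>
  Pi.single f.1 (1 / D.h ^ (d - 1)
    * hat ((x (D.axis f.1) - D.origin (D.axis f.1)) / D.h - f.2 (D.axis f.1))
    * ∏ j ∈ Finset.univ.erase (D.axis f.1),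
        Set.indicator (Set.Ico (0 : ℝ) 1) (fun _ => (1 : ℝ))
          ((x j - D.origin j) / D.h - f.2 j))

/-! ## Combinatorics of the mesh -/

/-- The local degree of freedom `(i, s)` of the cell `K`: the facet of type `i` on the lower
(`s = 0`) or upper (`s = 1`) side of `K` with respect to `axis i`. -/
def facetOf (K : Cell d) (p : Fin d × Fin 2) : Facet d :=
  (p.1, fun j => K j + if j = D.axis p.1 then ((p.2 : ℕ) : ℤ) else 0)

/-- The facets (degrees of freedom) of a mesh. -/
def facets (M : Finset (Cell d)) : Finset (Facet d) :=
  M.biUnion fun K => Finset.univ.image (D.facetOf K)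

theorem facetOf_mem (K : Cell d) (p : Fin d × Fin 2) : D.facetOf K p ∈ D.facets {K} := by
  simp [facets]

/-- One regular refinement step: each cell is divided into `2^d` cells of half the size. -/
def refine {d : ℕ} (M : Finset (Cell d)) : Finset (Cell d) :=
  M.biUnion fun K => Finset.univ.image fun s : Fin d → Fin 2 => fun j => 2 * K j + ((s j : ℕ) : ℤ)

/-- The facets of the refined mesh that lie in the interior of the macro elements. -/
def interiorFacets (M : Finset (Cell d)) : Finset (Facet d) :=
  (D.facets (refine M)).filter fun f => Odd (f.2 (D.axis f.1))

/-- The labels of the differences: a facet `F` of the coarse mesh together with a nonempty set `S`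
of coordinate directions along `F` (one such `S` for an edge, three for a face). -/
def differences (M : Finset (Cell d)) : Finset (Facet d × Finset (Fin d)) :=
  (D.facets M ×ˢ Finset.univ).filter fun q => q.2.Nonempty ∧ D.axis q.1.1 ∉ q.2

/-- `f` is one of the `2^(d-1)` facets of the refined mesh that make up the coarse facet `F`. -/
def IsChild (F f : Facet d) : Prop :=
  f.1 = F.1 ∧ f.2 (D.axis F.1) = 2 * F.2 (D.axis F.1) ∧
    ∀ j, j ≠ D.axis F.1 → f.2 j = 2 * F.2 j ∨ f.2 j = 2 * F.2 j + 1

instance (F f : Facet d) : Decidable (D.IsChild F f) := by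
  unfold IsChild; infer_instance

/-! ## Two-level hierarchical basis, static condensation, recursion -/

/-- Interior rows of the hierarchical basis transformation. -/
def Jint (M : Finset (Cell d)) : Matrix (D.interiorFacets M) (D.facets (refine M)) ℝ :=
  fun f g => if (f : Facet d) = g then 1 else 0

/-- Difference rows: for `d = 2` the row `(1/2) (1, -1)` of each coarse edge, for `d = 3` the rows
`(1/4) (1, -1, 1, -1)`, `(1/4) (1, 1, -1, -1)`, `(1/4) (1, -1, -1, 1)` of each coarse face. -/
def Jdiff (M : Finset (Cell d)) : Matrix (D.differences M) (D.facets (refine M)) ℝ :=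
  fun q g => if D.IsChild q.1.1 g then
    1 / 2 ^ (d - 1) * ∏ j ∈ q.1.2, (if Even (g.1.2 j) then (1 : ℝ) else -1) else 0

/-- Aggregate rows: `(1/2) (1, 1)` for each coarse edge, `(1/4) (1, 1, 1, 1)` for each coarse
face. -/
def Jagg (M : Finset (Cell d)) : Matrix (D.facets M) (D.facets (refine M)) ℝ :=
  fun F g => if D.IsChild F g then 1 / 2 ^ (d - 1) else 0

/-- The two-level hierarchical basis transformation, with the numbering
interior, differences, aggregates. -/
def J (M : Finset (Cell d)) :
    Matrix (D.interiorFacets M ⊕ (D.differences M ⊕ D.facets M)) (D.facets (refine M)) ℝ :=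
  Matrix.fromRows (D.Jint M) (Matrix.fromRows (D.Jdiff M) (D.Jagg M))

/-- The hierarchical matrix `J A Jᵀ`. -/
def hier (M : Finset (Cell d)) (A : Matrix (D.facets (refine M)) (D.facets (refine M)) ℝ) :
    Matrix (D.interiorFacets M ⊕ (D.differences M ⊕ D.facets M))
      (D.interiorFacets M ⊕ (D.differences M ⊕ D.facets M)) ℝ :=
  D.J M * A * (D.J M)ᵀ

/-- The Schur complement `B` that is left after static condensation of the interior unknowns. -/
def condensed (M : Finset (Cell d)) (A : Matrix (D.facets (refine M)) (D.facets (refine M)) ℝ) :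
    Matrix (D.differences M ⊕ D.facets M) (D.differences M ⊕ D.facets M) ℝ :=
  (D.hier M A).toBlocks₂₂
    - (D.hier M A).toBlocks₂₁ * ((D.hier M A).toBlocks₁₁)⁻¹ * (D.hier M A).toBlocks₁₂

/-- The coarse matrix: the aggregates block `B₂₂`. -/
def coarse (M : Finset (Cell d)) (A : Matrix (D.facets (refine M)) (D.facets (refine M)) ℝ) :
    Matrix (D.facets M) (D.facets M) ℝ :=
  (D.condensed M A).toBlocks₂₂

/-- `stiffness k M` is the global matrix on the mesh `M` obtained by `k` coarsening steps from the
stiffness matrix of the model form on the `k` times refined mesh, whose cells have side `h`. -/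
def stiffness : ℕ → (M : Finset (Cell d)) → Matrix (D.facets M) (D.facets M) ℝ
  | 0, M => fun f g => D.form (D.domain M) (D.basisField f) (D.basisField g)
  | k + 1, M => D.coarse M (stiffness k (refine M))

/-- Assembly `∑_K R_Kᵀ A_K R_K` of element matrices. -/
def assemble (A : Cell d → Matrix (Fin d × Fin 2) (Fin d × Fin 2) ℝ) (M : Finset (Cell d)) :
    Matrix (D.facets M) (D.facets M) ℝ :=
  fun f g => ∑ K ∈ M, ∑ p, ∑ q,
    if D.facetOf K p = f ∧ D.facetOf K q = g then A K p q else 0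

/-- `elementMatrix k K` is the element matrix after `k` coarsening steps: first the matrix of
`α ∫_K u · v + β ∫_K X u X v`, then recursively the aggregates block `B_{G,22}` of the macro element
`G` which consists of the `2^d` children of `K`. -/
def elementMatrix : ℕ → Cell d → Matrix (Fin d × Fin 2) (Fin d × Fin 2) ℝ
  | 0, K => fun p q =>
      D.form (D.cell K) (D.basisField (D.facetOf K p)) (D.basisField (D.facetOf K q))
  | k + 1, K => fun p q =>
      D.coarse {K} (D.assemble (elementMatrix k) (refine {K}))
        ⟨D.facetOf K p, D.facetOf_mem K p⟩ ⟨D.facetOf K q, D.facetOf_mem K q⟩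

end Discretization

/-! ## CBS constants -/

/-- The quotients `B(u, v) / √(B(u, u) B(v, v))`, where `u` and `v` are nonzero vectors of the
first and of the second summand of the splitting. -/
def cbsQuotients {m n : Type*} [Fintype m] [Fintype n] (B : Matrix (m ⊕ n) (m ⊕ n) ℝ) : Set ℝ :=
  {r | ∃ (u : m → ℝ) (v : n → ℝ), u ≠ 0 ∧ v ≠ 0 ∧
    r = Sum.elim u 0 ⬝ᵥ B *ᵥ Sum.elim 0 v /
      √((Sum.elim u 0 ⬝ᵥ B *ᵥ Sum.elim u 0) * (Sum.elim 0 v ⬝ᵥ B *ᵥ Sum.elim 0 v))}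

namespace Discretization

variable {d : ℕ} (D : Discretization d)

/-- The quotients on the macro element `G` (a coarse cell with its children) in the splitting that
follows `k` coarsening steps. -/
def localQuotients (k : ℕ) (G : Cell d) : Set ℝ :=
  cbsQuotients (D.condensed {G} (D.assemble (D.elementMatrix k) (refine {G})))

/-- The local CBS constant on the macro element `G` in the splitting that follows `k` coarsening
steps. -/
def localCBS (k : ℕ) (G : Cell d) : ℝ := sSup (D.localQuotients k G)

/-- The macro elements at level `l`, that is, the cells of the coarse mesh in the splitting at level
`l`; the mesh at level `l` is their refinement. -/
def macroElements {d : ℕ} (M : Finset (Cell d)) (l : ℕ) : Finset (Cell d) := refine^[l] M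

/-- The quotients of the global splitting at level `l`, when the finest level is `L`. -/
def globalQuotients (M : Finset (Cell d)) (L l : ℕ) : Set ℝ :=
  cbsQuotients (D.condensed (macroElements M l)
    (D.stiffness (L - l) (refine (macroElements M l))))

/-- The CBS constant of the global splitting at level `l`, when the finest level is `L`. -/
def globalCBS (M : Finset (Cell d)) (L l : ℕ) : ℝ := sSup (D.globalQuotients M L l)

end Discretization

/-! ## The sequences and the closed form of the element matrices -/

/-- The pairs `(a_l, b_l)`. -/
def seqAB (e : ℝ) : ℕ → ℝ × ℝ
  | 0 => (2 * e + 6, e - 6)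
  | l + 1 => (2 * (seqAB e l).1 + -(seqAB e l).2 ^ 2 / (seqAB e l).1,
      -(seqAB e l).2 ^ 2 / (seqAB e l).1)

/-- `a_0 = 2 e + 6`, `a_{l+1} = 2 a_l + b_{l+1}`. -/
def seqA (e : ℝ) (l : ℕ) : ℝ := (seqAB e l).1

/-- `b_0 = e - 6`, `b_{l+1} = - b_l² / a_l`. -/
def seqB (e : ℝ) (l : ℕ) : ℝ := (seqAB e l).2

/-- With the local numbering `(0,0), (0,1), (1,0), (1,1), …` this is the matrix with diagonal blocks
`[a, b; b, a]` and with all other blocks `[c, -c; -c, c]`. -/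
def blockPattern (d : ℕ) (a b c : ℝ) : Matrix (Fin d × Fin 2) (Fin d × Fin 2) ℝ :=
  fun p q => if p.1 = q.1 then (if p.2 = q.2 then a else b) else (if p.2 = q.2 then c else -c)

end

/-! Both problems share one structure. Up to a positive factor, the energy of a cell is a sum over
the facet types `i` of decoupled quadratic forms in the two values of each pair, with diagonal `a -
6` and off-diagonal `b + 6`, plus 6 times the square of the signed jump Σ σ_i (upper - lower), where
σ = (-1, 1) for the curl and σ = 1 for the divergence. On a macro element, reflections of the
children make almost all cross terms cancel by parity, so one computation in dimension `d` serves
both cases.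

Let S_i be the sum and E_i half the difference of the two aggregates of type `i`. The energy
minimizing extension of the aggregates, with zero differences, has interior values proportional to
-b/(2a) S_i. Its energy has the old form again, with `a`, `b` replaced according to the recursion
and the factor divided by 2^d. Since this extension is computed cell by cell, coarsening commutes
with assembly (`coarse_assemble`), and induction gives the element and global matrices of all
levels.

A suitable choice of differences and interior values gives a second extension of the same
aggregates, orthogonal in energy to every function with vanishing aggregates. The harmonic extension
minus this one, `differenceTrial`, therefore represents, on functions with vanishing aggregates, the
pairing with the harmonic extension. Its energy is `cbsSq` times the S part of the harmonic energy.
Cauchy-Schwarz then gives the local bound, which is attained for E = 0, and summation over the cells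
gives the global bound. The global bound is attained as well: aggregates with checkerboard signs
have E = 0 on every cell, and the locally optimal differences agree on shared facets
(`macroValues_checker`). Thus the local and global constants of a level coincide
(`isGreatest_cbsQuotients`), which is what makes the global ones strictly monotone too.

What remains is scalar. That `cbsSq` decreases under the recursion amounts to positivity of a
polynomial in (a/6, b/6), proved on the invariant set `DecreasingRegion`, which contains the initial
pair for every e > 0. The bound Θ is then only needed before any coarsening, where it is the limit
of an explicit function of `e` as e → 0. -/

noncomputable section

/-! ## Signs and reflections of the children of a macro element -/

/-- The sign `(-1)^(s j)` of the child `s` with respect to the axis `j`. -/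
def childSign {d : ℕ} (s : Fin d → Fin 2) (j : Fin d) : ℝ := if s j = 0 then 1 else -1

/-- The mirror image of the child `s` with respect to the axis `j`. -/
def mirror {d : ℕ} (j : Fin d) (s : Fin d → Fin 2) : Fin d → Fin 2 :=
  Function.update s j (1 - s j)

section mirror

variable {d : ℕ}

theorem childSign_mul_self (s : Fin d → Fin 2) (j : Fin d) :
    childSign s j * childSign s j = 1 := by
  unfold childSign; split_ifs <;> norm_num

theorem mirror_involutive (j : Fin d) : Function.Involutive (mirror j) := by
  intro s
  unfold mirror
  ext k
  by_cases hk : k = j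
  · subst hk; simp
  · simp [hk]

theorem childSign_mirror_self (s : Fin d → Fin 2) (j : Fin d) :
    childSign (mirror j s) j = -childSign s j := by
  unfold childSign mirror
  rw [Function.update_self]
  generalize s j = t
  fin_cases t <;> simp

theorem childSign_mirror_of_ne (s : Fin d → Fin 2) {j k : Fin d} (h : k ≠ j) :
    childSign (mirror j s) k = childSign s k := by
  simp [childSign, mirror, h]

theorem sum_mirror {f : (Fin d → Fin 2) → ℝ} (j : Fin d) : ∑ s, f (mirror j s) = ∑ s, f s :=
  Equiv.sum_comp (mirror_involutive j).toPerm f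

/-- The parity principle behind all cancellations below: reflection permutes the children, so an odd
function has sum zero. -/
theorem sum_eq_zero_of_mirror {f : (Fin d → Fin 2) → ℝ} (j : Fin d)
    (h : ∀ s, f (mirror j s) = -f s) : ∑ s, f s = 0 := by
  have h1 := sum_mirror (f := f) j
  simp only [h, Finset.sum_neg_distrib] at h1
  linarith

end mirror

/-! ## The energy form of a macro element -/

/-- The values of a finite element function on a macro element: for the child `s` and each facet
type `i`, the value on the facet on the boundary and the value on the facet in the interior of the
macro element. -/
abbrev MacroVec (d : ℕ) := (Fin d → Fin 2) → Fin d → ℝ × ℝ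

/-- The signed jump (local divergence) of the values on the child `s`. -/
def jump {d : ℕ} (σ : Fin d → ℝ) (π : Fin d → Fin d) (s : Fin d → Fin 2) (x : Fin d → ℝ × ℝ) : ℝ :=
  ∑ i, σ i * childSign s (π i) * ((x i).2 - (x i).1)

/-- The energy form of a macro element whose cells have the element matrix
`blockPattern d a b (6 σ_i σ_j)`. -/
def macroForm {d : ℕ} (a b : ℝ) (σ : Fin d → ℝ) (π : Fin d → Fin d) :
    LinearMap.BilinForm ℝ (MacroVec d) :=
  LinearMap.mk₂ ℝ (fun x y => ∑ s, ((∑ i, ((a - 6) * ((x s i).1 * (y s i).1 + (x s i).2 * (y s i).2)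
      + (b + 6) * ((x s i).1 * (y s i).2 + (x s i).2 * (y s i).1)))
      + 6 * jump σ π s (x s) * jump σ π s (y s)))
    (by
      intro x x' y
      simp only [jump, Pi.add_apply, Prod.fst_add, Prod.snd_add, mul_add, add_mul, mul_sub, sub_mul,
        Finset.sum_add_distrib, Finset.sum_sub_distrib]
      ring)
    (by
      intro c x y
      simp only [smul_eq_mul, Finset.mul_sum, mul_add]
      refine Finset.sum_congr rfl fun s _ => ?_
      congr 1
      · refine Finset.sum_congr rfl fun i _ => ?_
        simp only [Pi.smul_apply, Prod.smul_fst, Prod.smul_snd, smul_eq_mul]; ring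
      · have : jump σ π s ((c • x) s) = c * jump σ π s (x s) := by
          simp only [jump, Finset.mul_sum]
          refine Finset.sum_congr rfl fun i _ => ?_
          simp only [Pi.smul_apply, Prod.smul_fst, Prod.smul_snd, smul_eq_mul]; ring
        rw [this]; ring)
    (by
      intro x y y'
      simp only [jump, Pi.add_apply, Prod.fst_add, Prod.snd_add, mul_add, add_mul, mul_sub, sub_mul,
        Finset.sum_add_distrib, Finset.sum_sub_distrib]
      ring)
    (by
      intro c x y
      simp only [smul_eq_mul, Finset.mul_sum, mul_add]
      refine Finset.sum_congr rfl fun s _ => ?_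
      congr 1
      · refine Finset.sum_congr rfl fun i _ => ?_
        simp only [Pi.smul_apply, Prod.smul_fst, Prod.smul_snd, smul_eq_mul]; ring
      · have : jump σ π s ((c • y) s) = c * jump σ π s (y s) := by
          simp only [jump, Finset.mul_sum]
          refine Finset.sum_congr rfl fun i _ => ?_
          simp only [Pi.smul_apply, Prod.smul_fst, Prod.smul_snd, smul_eq_mul]; ring
        rw [this]; ring)

/-- The values in the interior of the macro element are shared by the two adjacent children. -/
def MacroConforming {d : ℕ} (π : Fin d → Fin d) (x : MacroVec d) : Prop :=
  ∀ s i, (x (mirror (π i) s) i).2 = (x s i).2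

/-- All aggregates of the boundary values vanish. -/
def ZeroAggregates {d : ℕ} (π : Fin d → Fin d) (x : MacroVec d) : Prop :=
  ∀ i, ∑ s, (x s i).1 = 0 ∧ ∑ s, childSign s (π i) * (x s i).1 = 0

/-- The family of macro element functions with boundary aggregates `S i / 2 ∓ E i`, interior values
`l * S i` and boundary differences proportional to `t`. -/
def macroTrial {d : ℕ} (σ : Fin d → ℝ) (π : Fin d → Fin d) (S E : Fin d → ℝ) (l t : ℝ) :
    MacroVec d := fun s i =>
  (S i / 2 - childSign s (π i) * E i
    + t * σ i * childSign s (π i) * ∑ k ∈ Finset.univ.erase i, σ k * childSign s (π k) * S k,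
   l * S i)

/-! ### Definiteness of the macro energy and its pairing with trial functions -/

section macroForm

variable {d : ℕ} {a b : ℝ} {σ : Fin d → ℝ} {π : Fin d → Fin d}

theorem macroForm_apply (x y : MacroVec d) : macroForm a b σ π x y =
    ∑ s, ((∑ i, ((a - 6) * ((x s i).1 * (y s i).1 + (x s i).2 * (y s i).2)
      + (b + 6) * ((x s i).1 * (y s i).2 + (x s i).2 * (y s i).1)))
      + 6 * jump σ π s (x s) * jump σ π s (y s)) := rfl

theorem macroForm_comm (x y : MacroVec d) : macroForm a b σ π x y = macroForm a b σ π y x := by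
  simp only [macroForm_apply]
  refine Finset.sum_congr rfl fun s _ => ?_
  congr 1
  · refine Finset.sum_congr rfl fun i _ => ?_
    ring
  · ring

/-- Diagonalization: twice the form is (a + b)(y + w)² + (a - b - 12)(y - w)². This is where the two
standing hypotheses on `a` and `b` come from. -/
theorem pair_energy_nonneg (hab : 0 < a + b) (hab' : 12 < a - b) (y w : ℝ) :
    0 ≤ (a - 6) * (y * y + w * w) + (b + 6) * (y * w + w * y) := by
  nlinarith [mul_nonneg hab.le (sq_nonneg (y + w)),
    mul_nonneg (sub_pos.2 hab').le (sq_nonneg (y - w))]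

theorem pair_energy_eq_zero (hab : 0 < a + b) (hab' : 12 < a - b) {y w : ℝ}
    (h : (a - 6) * (y * y + w * w) + (b + 6) * (y * w + w * y) = 0) : y = 0 ∧ w = 0 := by
  have h1 := mul_nonneg hab.le (sq_nonneg (y + w))
  have h2 := mul_nonneg (sub_pos.2 hab').le (sq_nonneg (y - w))
  have h3 : (a + b) * (y + w) ^ 2 = 0 := by nlinarith
  have h4 : (a - b - 12) * (y - w) ^ 2 = 0 := by nlinarith
  have h5 : y + w = 0 := by
    rcases mul_eq_zero.1 h3 with h | h
    · linarith
    · exact pow_eq_zero_iff (two_ne_zero) |>.1 h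
  have h6 : y - w = 0 := by
    rcases mul_eq_zero.1 h4 with h | h
    · linarith
    · exact pow_eq_zero_iff (two_ne_zero) |>.1 h
  constructor <;> linarith

theorem child_energy_nonneg (hab : 0 < a + b) (hab' : 12 < a - b) (x : MacroVec d)
    (s : Fin d → Fin 2) :
    0 ≤ (∑ i, ((a - 6) * ((x s i).1 * (x s i).1 + (x s i).2 * (x s i).2)
      + (b + 6) * ((x s i).1 * (x s i).2 + (x s i).2 * (x s i).1)))
      + 6 * jump σ π s (x s) * jump σ π s (x s) := by
  have := Finset.sum_nonneg fun i (_ : i ∈ Finset.univ) =>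
    pair_energy_nonneg hab hab' (x s i).1 (x s i).2
  nlinarith [mul_self_nonneg (jump σ π s (x s))]

theorem macroForm_self_nonneg (hab : 0 < a + b) (hab' : 12 < a - b) (x : MacroVec d) :
    0 ≤ macroForm a b σ π x x := by
  rw [macroForm_apply]
  exact Finset.sum_nonneg fun s _ => child_energy_nonneg hab hab' x s

theorem eq_zero_of_macroForm_self (hab : 0 < a + b) (hab' : 12 < a - b) {x : MacroVec d}
    (h : macroForm a b σ π x x = 0) : x = 0 := by
  rw [macroForm_apply,
    Finset.sum_eq_zero_iff_of_nonneg fun s _ => child_energy_nonneg hab hab' x s] at h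
  ext s i : 2
  have h1 := h s (Finset.mem_univ s)
  have h2 : ∀ i ∈ Finset.univ, 0 ≤ (a - 6) * ((x s i).1 * (x s i).1 + (x s i).2 * (x s i).2)
      + (b + 6) * ((x s i).1 * (x s i).2 + (x s i).2 * (x s i).1) :=
    fun i _ => pair_energy_nonneg hab hab' (x s i).1 (x s i).2
  have h3 : ∑ i, ((a - 6) * ((x s i).1 * (x s i).1 + (x s i).2 * (x s i).2)
      + (b + 6) * ((x s i).1 * (x s i).2 + (x s i).2 * (x s i).1)) = 0 := by
    nlinarith [mul_self_nonneg (jump σ π s (x s)), Finset.sum_nonneg h2]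
  have h4 := pair_energy_eq_zero hab hab' ((Finset.sum_eq_zero_iff_of_nonneg h2).1 h3 i
    (Finset.mem_univ i))
  exact Prod.ext h4.1 h4.2

theorem macroForm_sq_le (hab : 0 < a + b) (hab' : 12 < a - b) (x y : MacroVec d) :
    macroForm a b σ π x y ^ 2 ≤ macroForm a b σ π x x * macroForm a b σ π y y := by
  have := (macroForm a b σ π).apply_mul_apply_le_of_forall_zero_le
    (macroForm_self_nonneg hab hab') x y
  rw [macroForm_comm y x] at this
  rwa [sq]

/-- Signs square to one, so the `t` terms contribute σ_k ε_k S_k once for every i ≠ k. This gives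
the factor d - 1 and leaves a single multiple of Σ σ_i ε_i S_i. -/
theorem jump_macroTrial (hσ : ∀ i, σ i * σ i = 1) (S E : Fin d → ℝ) (l t : ℝ)
    (s : Fin d → Fin 2) : jump σ π s (macroTrial σ π S E l t s) =
      ∑ i, σ i * E i + (l - 1 / 2 - (d - 1) * t) * ∑ i, σ i * childSign s (π i) * S i := by
  have h : ∀ i, σ i * childSign s (π i) *
      ((macroTrial σ π S E l t s i).2 - (macroTrial σ π S E l t s i).1) =
      σ i * E i + (l - 1 / 2 + t) * (σ i * childSign s (π i) * S i)
        - t * ∑ k, σ k * childSign s (π k) * S k := by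
    intro i
    have h1 := childSign_mul_self s (π i)
    have h2 := hσ i
    simp only [macroTrial]
    rw [← Finset.add_sum_erase _ _ (Finset.mem_univ i)]
    generalize ∑ k ∈ Finset.univ.erase i, σ k * childSign s (π k) * S k = T
    generalize childSign s (π i) = c at *
    linear_combination (σ i * E i - t * T * (σ i * σ i) ) * h1 - t * T * h2
  simp only [jump, h, Finset.sum_add_distrib, Finset.sum_sub_distrib, ← Finset.mul_sum,
    Finset.sum_const, Finset.card_univ, Fintype.card_fin, nsmul_eq_mul]
  ring

/-- The residual at an interior facet is the sum of those of its two adjacent children. Its part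
even under the reflection is S_i times the left side of `hl`, and its odd part cancels. Hence only
the boundary values of `x` survive, and their coefficient splits into a constant, a multiple of ε_i,
and products of two different signs. -/
theorem macroForm_macroTrial (hσ : ∀ i, σ i * σ i = 1) (hπ : Function.Injective π) {l t : ℝ}
    (hl : (a - 6) * l + (b + 6) / 2 + 6 * (l - 1 / 2 - (d - 1) * t) = 0)
    {x : MacroVec d} (hx : MacroConforming π x) (S E : Fin d → ℝ) :
    macroForm a b σ π x (macroTrial σ π S E l t) = ∑ i, ∑ s, (x s i).1 *
      (((a - 6) / 2 + (b + 6) * l - 6 * (l - 1 / 2 - (d - 1) * t)) * S i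
        - childSign s (π i) * ((a - 6) * E i + 6 * σ i * ∑ k, σ k * E k)
        + ((a - 6) * t - 6 * (l - 1 / 2 - (d - 1) * t)) *
          (σ i * childSign s (π i) *
            ∑ k ∈ Finset.univ.erase i, σ k * childSign s (π k) * S k)) := by
  set τ := l - 1 / 2 - (d - 1) * t with hτ
  -- The odd part of the interior residual: the interior value of `x` is shared by mirror images,
  -- while the bracket changes sign.
  have key : ∀ i, ∑ s, (x s i).2 * (childSign s (π i) * (-(b + 6) * E i
      + (b + 6) * t * σ i * (∑ k ∈ Finset.univ.erase i, σ k * childSign s (π k) * S k)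
      + 6 * σ i * (∑ k, σ k * E k)
      + 6 * τ * σ i * ∑ k ∈ Finset.univ.erase i, σ k * childSign s (π k) * S k)) = 0 := by
    intro i
    refine sum_eq_zero_of_mirror (π i) fun s => ?_
    have h : ∀ k ∈ Finset.univ.erase i, σ k * childSign (mirror (π i) s) (π k) * S k =
        σ k * childSign s (π k) * S k := by
      intro k hk
      rw [childSign_mirror_of_ne s (hπ.ne (Finset.ne_of_mem_erase hk))]
    rw [hx, Finset.sum_congr rfl h, childSign_mirror_self]
    ring
  -- After adding these vanishing sums, the two sides agree child by child and type by type.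
  rw [macroForm_apply, ← add_zero (∑ i, ∑ s, _), ← Finset.sum_eq_zero fun i (_ : i ∈ Finset.univ) =>
    key i, ← Finset.sum_add_distrib]
  simp only [← Finset.sum_add_distrib]
  rw [Finset.sum_comm]
  refine Finset.sum_congr rfl fun s _ => ?_
  rw [jump_macroTrial hσ, ← hτ, jump, mul_assoc, Finset.sum_mul, Finset.mul_sum,
    ← Finset.sum_add_distrib]
  refine Finset.sum_congr rfl fun i _ => ?_
  have h1 := childSign_mul_self s (π i)
  have h2 := hσ i
  simp only [macroTrial]
  rw [← Finset.add_sum_erase (a := i) (f := fun i => σ i * childSign s (π i) * S i) _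
    (Finset.mem_univ i)]
  generalize ∑ k ∈ Finset.univ.erase i, σ k * childSign s (π k) * S k = T
  generalize childSign s (π i) = c at *
  generalize ∑ k, σ k * E k = C
  linear_combination (6 * τ * ((x s i).2 - (x s i).1) * S i * (σ i * σ i)) * h1
    + (6 * τ * ((x s i).2 - (x s i).1) * S i) * h2 + (x s i).2 * S i * hl

end macroForm

/-! ### Harmonic, orthogonal and difference extensions on one macro element -/

/-- The energy minimizing extension of the coarse values with aggregates `S i / 2 ∓ E i`. -/
def harmonicTrial {d : ℕ} (a b : ℝ) (σ : Fin d → ℝ) (π : Fin d → Fin d) (S E : Fin d → ℝ) :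
    MacroVec d := macroTrial σ π S E (-b / (2 * a)) 0

/-- The amplitude of the optimal differences. -/
def diffAmplitude (d : ℕ) (a b : ℝ) : ℝ := -(3 * (a + b)) / ((a - 6) * (a + 6 * (d - 1)))

/-- The extension that is orthogonal to all functions with vanishing aggregates. -/
def orthogonalTrial {d : ℕ} (a b : ℝ) (σ : Fin d → ℝ) (π : Fin d → Fin d) (S E : Fin d → ℝ) :
    MacroVec d := macroTrial σ π S E
      (1 / 2 + (d - 1) * diffAmplitude d a b + (a - 6) / 6 * diffAmplitude d a b)
      (diffAmplitude d a b)

/-- The square of the CBS constant. -/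
def cbsSq (d : ℕ) (a b : ℝ) : ℝ :=
  36 * (d - 1) * (a + b) / ((a - 6) * (a + 6 * (d - 1)) * (a - b))

section trial

variable {d : ℕ} {a b : ℝ} {σ : Fin d → ℝ} {π : Fin d → Fin d}

theorem macroConforming_macroTrial (S E : Fin d → ℝ) (l t : ℝ) :
    MacroConforming π (macroTrial σ π S E l t) := fun _ _ => rfl

theorem sum_childSign (j : Fin d) : ∑ s : Fin d → Fin 2, childSign s j = 0 :=
  sum_eq_zero_of_mirror j fun s => childSign_mirror_self s j

theorem sum_mul_erase_childSign (i : Fin d) (c : Fin d → ℝ)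
    {g : (Fin d → Fin 2) → ℝ} (hg : ∀ k, k ≠ i → ∀ s, g (mirror (π k) s) = g s) :
    ∑ s, g s * ∑ k ∈ Finset.univ.erase i, σ k * childSign s (π k) * c k = 0 := by
  simp only [Finset.mul_sum]
  rw [Finset.sum_comm]
  refine Finset.sum_eq_zero fun k hk => sum_eq_zero_of_mirror (π k) fun s => ?_
  rw [hg k (Finset.ne_of_mem_erase hk), childSign_mirror_self]
  ring

/-- The `t` term is a combination of products ε_i ε_k with k ≠ i, which are orthogonal to both 1 and
ε_i. So neither `t` nor the interior scaling `l` affects the aggregates. -/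
theorem zeroAggregates_sub (hπ : Function.Injective π) (S E : Fin d → ℝ) (l l' t t' : ℝ) :
    ZeroAggregates π (macroTrial σ π S E l t - macroTrial σ π S E l' t') := by
  have h : ∀ s i, ((macroTrial σ π S E l t - macroTrial σ π S E l' t') s i).1 =
      ((t - t') * σ i) * (childSign s (π i) *
        ∑ k ∈ Finset.univ.erase i, σ k * childSign s (π k) * S k) := by
    intro s i
    simp only [macroTrial, Pi.sub_apply, Prod.fst_sub]; ring
  intro i
  constructor
  · simp only [h, ← Finset.mul_sum]
    rw [sum_mul_erase_childSign i S, mul_zero]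
    intro k hk s
    rw [childSign_mirror_of_ne s (hπ.ne hk.symm)]
  · have h' : ∀ s, childSign s (π i) *
        ((macroTrial σ π S E l t - macroTrial σ π S E l' t') s i).1 = ((t - t') * σ i) *
        (1 * ∑ k ∈ Finset.univ.erase i, σ k * childSign s (π k) * S k) := by
      intro s
      rw [h]
      linear_combination ((t - t') * σ i *
        ∑ k ∈ Finset.univ.erase i, σ k * childSign s (π k) * S k) * childSign_mul_self s (π i)
    simp only [h', ← Finset.mul_sum]
    rw [Finset.mul_sum, sum_mul_erase_childSign i S, mul_zero]
    intros; rfl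

theorem macroForm_macroTrial_of_interior (hσ : ∀ i, σ i * σ i = 1) (hπ : Function.Injective π)
    {l t : ℝ} (hl : (a - 6) * l + (b + 6) / 2 + 6 * (l - 1 / 2 - (d - 1) * t) = 0)
    {x : MacroVec d} (hx : MacroConforming π x) (hx0 : ∀ s i, (x s i).1 = 0) (S E : Fin d → ℝ) :
    macroForm a b σ π x (macroTrial σ π S E l t) = 0 := by
  rw [macroForm_macroTrial hσ hπ hl hx]
  simp [hx0]

/-- By `ht` the boundary residual has no ε_i ε_k part. What is left is spanned by 1 and ε_i, exactly
the functions that vanishing aggregates annihilate. -/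
theorem macroForm_macroTrial_of_zeroAggregates (hσ : ∀ i, σ i * σ i = 1)
    (hπ : Function.Injective π) {l t : ℝ}
    (hl : (a - 6) * l + (b + 6) / 2 + 6 * (l - 1 / 2 - (d - 1) * t) = 0)
    (ht : (a - 6) * t - 6 * (l - 1 / 2 - (d - 1) * t) = 0)
    {x : MacroVec d} (hx : MacroConforming π x) (hx0 : ZeroAggregates π x) (S E : Fin d → ℝ) :
    macroForm a b σ π x (macroTrial σ π S E l t) = 0 := by
  rw [macroForm_macroTrial hσ hπ hl hx, ht]
  refine Finset.sum_eq_zero fun i _ => ?_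
  have h1 := (hx0 i).1
  have h2 := (hx0 i).2
  set A := ((a - 6) / 2 + (b + 6) * l - 6 * (l - 1 / 2 - (d - 1) * t)) * S i
  set C := (a - 6) * E i + 6 * σ i * ∑ k, σ k * E k
  calc _ = A * ∑ s, (x s i).1 - C * ∑ s, childSign s (π i) * (x s i).1 := by
        rw [Finset.mul_sum, Finset.mul_sum, ← Finset.sum_sub_distrib]
        exact Finset.sum_congr rfl fun s _ => by ring
    _ = 0 := by rw [h1, h2]; ring

/-- With zero differences on the left, only the characters 1 and ε_i are tested. They are orthogonal
to each other and to every ε_i ε_k, and each has squared norm 2^d. -/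
theorem macroForm_trial_trial (hσ : ∀ i, σ i * σ i = 1) (hπ : Function.Injective π) {l l' t : ℝ}
    (hl : (a - 6) * l + (b + 6) / 2 + 6 * (l - 1 / 2 - (d - 1) * t) = 0)
    (S E S' E' : Fin d → ℝ) :
    macroForm a b σ π (macroTrial σ π S' E' l' 0) (macroTrial σ π S E l t) =
      2 ^ d * ∑ i, (((a - 6) / 2 + (b + 6) * l - 6 * (l - 1 / 2 - (d - 1) * t)) * (S' i / 2 * S i)
        + E' i * ((a - 6) * E i + 6 * σ i * ∑ k, σ k * E k)) := by
  rw [macroForm_macroTrial hσ hπ hl (macroConforming_macroTrial _ _ _ _), Finset.mul_sum]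
  refine Finset.sum_congr rfl fun i _ => ?_
  set A := (a - 6) / 2 + (b + 6) * l - 6 * (l - 1 / 2 - (d - 1) * t)
  set C := (a - 6) * E i + 6 * σ i * ∑ k, σ k * E k
  set B := (a - 6) * t - 6 * (l - 1 / 2 - (d - 1) * t)
  have h1 : ∑ s : Fin d → Fin 2, childSign s (π i) = 0 := sum_childSign _
  have h2 : ∑ s : Fin d → Fin 2, childSign s (π i) *
      ∑ k ∈ Finset.univ.erase i, σ k * childSign s (π k) * S k = 0 :=
    sum_mul_erase_childSign i S fun k hk s => childSign_mirror_of_ne s (hπ.ne hk.symm)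
  have h3 : ∑ s : Fin d → Fin 2, (1 : ℝ) *
      ∑ k ∈ Finset.univ.erase i, σ k * childSign s (π k) * S k = 0 :=
    sum_mul_erase_childSign i S fun k hk s => rfl
  have h4 : ∑ _s : Fin d → Fin 2, (1 : ℝ) = 2 ^ d := by simp
  calc _ = (A * (S' i / 2 * S i) + E' i * C) * ∑ _s : Fin d → Fin 2, (1 : ℝ)
        - (S' i / 2 * C + E' i * A * S i) * ∑ s : Fin d → Fin 2, childSign s (π i)
        + S' i / 2 * B * σ i * ∑ s : Fin d → Fin 2, childSign s (π i) *
          ∑ k ∈ Finset.univ.erase i, σ k * childSign s (π k) * S k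
        - E' i * B * σ i * ∑ s : Fin d → Fin 2, (1 : ℝ) *
          ∑ k ∈ Finset.univ.erase i, σ k * childSign s (π k) * S k := by
        rw [Finset.mul_sum, Finset.mul_sum, Finset.mul_sum, Finset.mul_sum,
          ← Finset.sum_sub_distrib, ← Finset.sum_add_distrib, ← Finset.sum_sub_distrib]
        refine Finset.sum_congr rfl fun s _ => ?_
        simp only [macroTrial]
        linear_combination (E' i * C - E' i * B * σ i *
          ∑ k ∈ Finset.univ.erase i, σ k * childSign s (π k) * S k) * childSign_mul_self s (π i)
    _ = _ := by rw [h1, h2, h3, h4]; ring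

/-- For t = 0 the terms with 6 cancel and the balance reads a l + b/2 = 0. -/
theorem harmonic_balance (ha : a ≠ 0) :
    (a - 6) * (-b / (2 * a)) + (b + 6) / 2 + 6 * (-b / (2 * a) - 1 / 2 - (d - 1) * 0) = 0 := by
  field_simp; ring

/-- Vanishing of the ε_i ε_k residual forces l - 1/2 - (d - 1) t = (a - 6) t / 6, the `l` of
`orthogonalTrial`. Inserted here, the balance becomes (a - 6)(a + 6(d - 1)) t = -3(a + b), which is
the definition of `diffAmplitude`. -/
theorem orthogonal_balance (hd : 1 ≤ d) (h6 : 6 < a) :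
    (a - 6) * (1 / 2 + (d - 1) * diffAmplitude d a b + (a - 6) / 6 * diffAmplitude d a b)
      + (b + 6) / 2 + 6 * ((1 / 2 + (d - 1) * diffAmplitude d a b
        + (a - 6) / 6 * diffAmplitude d a b) - 1 / 2 - (d - 1) * diffAmplitude d a b) = 0 := by
  have h1 : (1 : ℝ) ≤ d := by exact_mod_cast hd
  have h2 : a - 6 ≠ 0 := by linarith
  have h3 : a + 6 * ((d : ℝ) - 1) ≠ 0 := by linarith
  have h4 : diffAmplitude d a b * ((a - 6) * (a + 6 * (d - 1))) = -(3 * (a + b)) := by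
    rw [diffAmplitude, div_mul_cancel₀ _ (mul_ne_zero h2 h3)]
  linear_combination h4 / 6

theorem macroForm_harmonic_harmonic (hσ : ∀ i, σ i * σ i = 1) (hπ : Function.Injective π)
    (ha : a ≠ 0) (S E S' E' : Fin d → ℝ) :
    macroForm a b σ π (harmonicTrial a b σ π S' E') (harmonicTrial a b σ π S E) =
      2 ^ d * ∑ i, ((a + b) * (a - b) / (2 * a) * (S' i / 2 * S i)
        + E' i * ((a - 6) * E i + 6 * σ i * ∑ k, σ k * E k)) := by
  rw [harmonicTrial, harmonicTrial, macroForm_trial_trial hσ hπ (harmonic_balance ha)]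
  have : (a - 6) / 2 + (b + 6) * (-b / (2 * a)) - 6 * (-b / (2 * a) - 1 / 2 - ((d : ℝ) - 1) * 0) =
      (a + b) * (a - b) / (2 * a) := by field_simp; ring
  rw [this]

theorem macroForm_harmonic_orthogonal (hσ : ∀ i, σ i * σ i = 1) (hπ : Function.Injective π)
    (hd : 1 ≤ d) (h6 : 6 < a) (hab : b < a) (S E S' E' : Fin d → ℝ) :
    macroForm a b σ π (harmonicTrial a b σ π S' E') (orthogonalTrial a b σ π S E) =
      2 ^ d * ∑ i, ((1 - cbsSq d a b) * ((a + b) * (a - b) / (2 * a)) * (S' i / 2 * S i)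
        + E' i * ((a - 6) * E i + 6 * σ i * ∑ k, σ k * E k)) := by
  rw [harmonicTrial, orthogonalTrial, macroForm_trial_trial hσ hπ (orthogonal_balance hd h6)]
  have h1 : (1 : ℝ) ≤ d := by exact_mod_cast hd
  have h2 : a - 6 ≠ 0 := by linarith
  have h3 : a + 6 * ((d : ℝ) - 1) ≠ 0 := by linarith
  have h4 : a - b ≠ 0 := by linarith
  have h5 : a ≠ 0 := by linarith
  have : (a - 6) / 2 + (b + 6) * (1 / 2 + (d - 1) * diffAmplitude d a b
      + (a - 6) / 6 * diffAmplitude d a b) - 6 * ((1 / 2 + (d - 1) * diffAmplitude d a b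
        + (a - 6) / 6 * diffAmplitude d a b) - 1 / 2 - (d - 1) * diffAmplitude d a b) =
      (1 - cbsSq d a b) * ((a + b) * (a - b) / (2 * a)) := by
    rw [cbsSq, diffAmplitude]
    field_simp
    ring
  rw [this]

theorem macroForm_orthogonal_of_zeroAggregates (hσ : ∀ i, σ i * σ i = 1)
    (hπ : Function.Injective π) (hd : 1 ≤ d) (h6 : 6 < a) {x : MacroVec d}
    (hx : MacroConforming π x) (hx0 : ZeroAggregates π x) (S E : Fin d → ℝ) :
    macroForm a b σ π x (orthogonalTrial a b σ π S E) = 0 :=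
  macroForm_macroTrial_of_zeroAggregates hσ hπ (orthogonal_balance hd h6) (by ring) hx hx0 S E

/-- The function with vanishing aggregates that represents the harmonic extension. -/
def differenceTrial {d : ℕ} (a b : ℝ) (σ : Fin d → ℝ) (π : Fin d → Fin d) (S E : Fin d → ℝ) :
    MacroVec d := harmonicTrial a b σ π S E - orthogonalTrial a b σ π S E

theorem zeroAggregates_differenceTrial (hπ : Function.Injective π) (S E : Fin d → ℝ) :
    ZeroAggregates π (differenceTrial a b σ π S E) := zeroAggregates_sub hπ S E _ _ _ _

theorem macroConforming_differenceTrial (S E : Fin d → ℝ) :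
    MacroConforming π (differenceTrial a b σ π S E) := fun _ _ => rfl

/-- The representation property: the pairing with the harmonic extension is an inner product with an
element that has vanishing aggregates itself. -/
theorem macroForm_differenceTrial (hσ : ∀ i, σ i * σ i = 1) (hπ : Function.Injective π)
    (hd : 1 ≤ d) (h6 : 6 < a) {x : MacroVec d} (hx : MacroConforming π x)
    (hx0 : ZeroAggregates π x) (S E : Fin d → ℝ) :
    macroForm a b σ π x (differenceTrial a b σ π S E) =
      macroForm a b σ π x (harmonicTrial a b σ π S E) := by
  rw [differenceTrial, map_sub, macroForm_orthogonal_of_zeroAggregates hσ hπ hd h6 hx hx0, sub_zero]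

theorem macroForm_differenceTrial_of_interior (hσ : ∀ i, σ i * σ i = 1)
    (hπ : Function.Injective π) (hd : 1 ≤ d) (h6 : 6 < a) {x : MacroVec d}
    (hx : MacroConforming π x) (hx0 : ∀ s i, (x s i).1 = 0) (S E : Fin d → ℝ) :
    macroForm a b σ π x (differenceTrial a b σ π S E) = 0 := by
  rw [differenceTrial, map_sub, harmonicTrial, orthogonalTrial,
    macroForm_macroTrial_of_interior hσ hπ (harmonic_balance (by linarith)) hx hx0,
    macroForm_macroTrial_of_interior hσ hπ (orthogonal_balance hd h6) hx hx0, sub_zero]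

/-- By the representation property this energy is (harmonic, harmonic) - (harmonic, orthogonal). The
`E` terms of the two coincide, and the `S` terms differ by the factor `cbsSq`. -/
theorem macroForm_differenceTrial_self (hσ : ∀ i, σ i * σ i = 1) (hπ : Function.Injective π)
    (hd : 1 ≤ d) (h6 : 6 < a) (hab : b < a) (S E : Fin d → ℝ) :
    macroForm a b σ π (differenceTrial a b σ π S E) (differenceTrial a b σ π S E) =
      cbsSq d a b * (2 ^ d * ∑ i, (a + b) * (a - b) / (2 * a) * (S i / 2 * S i)) := by
  rw [macroForm_differenceTrial hσ hπ hd h6 (macroConforming_differenceTrial S E)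
    (zeroAggregates_differenceTrial hπ S E), macroForm_comm, differenceTrial, map_sub,
    macroForm_harmonic_harmonic hσ hπ (by linarith),
    macroForm_harmonic_orthogonal hσ hπ hd h6 hab, ← mul_sub, ← Finset.sum_sub_distrib,
    mul_left_comm, Finset.mul_sum (s := Finset.univ) (a := cbsSq d a b)]
  congr 1
  exact Finset.sum_congr rfl fun i _ => by ring

theorem cbsSq_nonneg (hd : 1 ≤ d) (h6 : 6 < a) (hab : 0 < a + b) (hab' : b < a) :
    0 ≤ cbsSq d a b := by
  have h1 : (0 : ℝ) ≤ d - 1 := sub_nonneg.2 (by exact_mod_cast hd)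
  have h2 : 0 < a - 6 := by linarith
  have h3 : 0 < a - b := by linarith
  unfold cbsSq
  positivity

/-- The harmonic energy has in addition a nonnegative part in `E`, so E = 0 is the worst case. -/
theorem macroForm_differenceTrial_le (hσ : ∀ i, σ i * σ i = 1) (hπ : Function.Injective π)
    (hd : 1 ≤ d) (hab : 0 < a + b) (hab' : 12 < a - b) (S E : Fin d → ℝ) :
    macroForm a b σ π (differenceTrial a b σ π S E) (differenceTrial a b σ π S E) ≤
      cbsSq d a b * macroForm a b σ π (harmonicTrial a b σ π S E) (harmonicTrial a b σ π S E) := by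
  have h6 : 6 < a := by linarith
  rw [macroForm_differenceTrial_self hσ hπ hd h6 (by linarith),
    macroForm_harmonic_harmonic hσ hπ (by linarith)]
  refine mul_le_mul_of_nonneg_left (mul_le_mul_of_nonneg_left ?_ (by positivity))
    (cbsSq_nonneg hd h6 hab (by linarith))
  rw [Finset.sum_add_distrib]
  have : ∑ i, E i * ((a - 6) * E i + 6 * σ i * ∑ k, σ k * E k) =
      (a - 6) * ∑ i, E i * E i + 6 * ((∑ k, σ k * E k) * ∑ k, σ k * E k) := by
    rw [Finset.sum_mul, Finset.mul_sum, Finset.mul_sum, ← Finset.sum_add_distrib]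
    exact Finset.sum_congr rfl fun i _ => by ring
  rw [this]
  have h1 : 0 ≤ ∑ i, E i * E i := Finset.sum_nonneg fun i _ => mul_self_nonneg _
  nlinarith [mul_nonneg (sub_pos.2 h6).le h1, mul_self_nonneg (∑ k, σ k * E k)]

theorem macroForm_harmonic_sq_le (hσ : ∀ i, σ i * σ i = 1) (hπ : Function.Injective π)
    (hd : 1 ≤ d) (hab : 0 < a + b) (hab' : 12 < a - b) {x : MacroVec d}
    (hx : MacroConforming π x) (hx0 : ZeroAggregates π x) (S E : Fin d → ℝ) :
    macroForm a b σ π x (harmonicTrial a b σ π S E) ^ 2 ≤ cbsSq d a b * (macroForm a b σ π x x *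
      macroForm a b σ π (harmonicTrial a b σ π S E) (harmonicTrial a b σ π S E)) := by
  rw [← macroForm_differenceTrial hσ hπ hd (by linarith) hx hx0, mul_left_comm]
  exact (macroForm_sq_le hab hab' _ _).trans (mul_le_mul_of_nonneg_left
    (macroForm_differenceTrial_le hσ hπ hd hab hab' S E) (macroForm_self_nonneg hab hab' x))

theorem macroForm_differenceTrial_self_eq (hσ : ∀ i, σ i * σ i = 1) (hπ : Function.Injective π)
    (hd : 1 ≤ d) (h6 : 6 < a) (hab : b < a) (S : Fin d → ℝ) :
    macroForm a b σ π (differenceTrial a b σ π S 0) (differenceTrial a b σ π S 0) =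
      cbsSq d a b *
        macroForm a b σ π (harmonicTrial a b σ π S 0) (harmonicTrial a b σ π S 0) := by
  rw [macroForm_differenceTrial_self hσ hπ hd h6 hab,
    macroForm_harmonic_harmonic hσ hπ (by linarith)]
  simp

end trial

/-! ## The hierarchical basis and static condensation -/

/-- The child with number `s` of the cell `K`. -/
def childCell {d : ℕ} (K : Cell d) (s : Fin d → Fin 2) : Cell d :=
  fun j => 2 * K j + ((s j : ℕ) : ℤ)

/-- The Schur complement acts on the remaining unknowns of a vector whose residual vanishes in the
eliminated rows. -/
theorem schur_mulVec {I U : Type*} [Fintype I] [DecidableEq I] [Fintype U]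
    (H : Matrix (I ⊕ U) (I ⊕ U) ℝ) (hH : IsUnit H.toBlocks₁₁.det) (w : I → ℝ) (u : U → ℝ)
    (h : ∀ i, (H *ᵥ Sum.elim w u) (Sum.inl i) = 0) :
    (H.toBlocks₂₂ - H.toBlocks₂₁ * (H.toBlocks₁₁)⁻¹ * H.toBlocks₁₂) *ᵥ u =
      fun k => (H *ᵥ Sum.elim w u) (Sum.inr k) := by
  have hb : H *ᵥ Sum.elim w u = Sum.elim (H.toBlocks₁₁ *ᵥ w + H.toBlocks₁₂ *ᵥ u)
      (H.toBlocks₂₁ *ᵥ w + H.toBlocks₂₂ *ᵥ u) := by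
    conv_lhs => rw [← Matrix.fromBlocks_toBlocks H, Matrix.fromBlocks_mulVec]
    simp
  rw [hb] at h ⊢
  have h1 : H.toBlocks₁₁ *ᵥ w = -(H.toBlocks₁₂ *ᵥ u) := by
    funext i
    have := h i
    simp only [Sum.elim_inl, Pi.add_apply] at this
    simp only [Pi.neg_apply]
    linarith
  have h2 : w = -((H.toBlocks₁₁)⁻¹ *ᵥ (H.toBlocks₁₂ *ᵥ u)) := by
    rw [← Matrix.mulVec_neg, ← h1, Matrix.mulVec_mulVec, Matrix.nonsing_inv_mul _ hH,
      Matrix.one_mulVec]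
  funext k
  simp only [Sum.elim_inr]
  rw [h2, Matrix.sub_mulVec, Matrix.mulVec_neg, Matrix.mulVec_mulVec, Matrix.mulVec_mulVec,
    Matrix.mul_assoc]
  simp only [Pi.sub_apply, Pi.add_apply, Pi.neg_apply]
  ring

theorem exists_stationary {I U : Type*} [Fintype I] [DecidableEq I] [Fintype U]
    (H : Matrix (I ⊕ U) (I ⊕ U) ℝ) (hH : IsUnit H.toBlocks₁₁.det) (u : U → ℝ) :
    ∃ w : I → ℝ, ∀ i, (H *ᵥ Sum.elim w u) (Sum.inl i) = 0 := by
  refine ⟨-((H.toBlocks₁₁)⁻¹ *ᵥ (H.toBlocks₁₂ *ᵥ u)), fun i => ?_⟩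
  conv_lhs => rw [← Matrix.fromBlocks_toBlocks H, Matrix.fromBlocks_mulVec]
  simp only [Matrix.fromBlocks_toBlocks, Sum.elim_comp_inl, Sum.elim_comp_inr, Sum.elim_inl,
    Matrix.mulVec_neg,
    Matrix.mulVec_mulVec, ← Matrix.mul_assoc]
  rw [Matrix.mul_nonsing_inv _ hH, Matrix.one_mul]
  simp

theorem isUnit_det_of_form_pos {I : Type*} [Fintype I] [DecidableEq I] (H : Matrix I I ℝ)
    (h : ∀ w, w ⬝ᵥ H *ᵥ w = 0 → w = 0) : IsUnit H.det := by
  rw [← Matrix.isUnit_iff_isUnit_det, ← Matrix.mulVec_injective_iff_isUnit]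
  intro v w hvw
  rw [← sub_eq_zero]
  apply h
  rw [Matrix.mulVec_sub, show H *ᵥ v = H *ᵥ w from hvw, sub_self, dotProduct_zero]

theorem childCell_inj {d : ℕ} {K K' : Cell d} {s s' : Fin d → Fin 2}
    (h : childCell K s = childCell K' s') : K = K' ∧ s = s' := by
  have h1 : ∀ j, K j = K' j ∧ s j = s' j := by
    intro j
    have := congrFun h j
    simp only [childCell] at this
    have h1 := (s j).isLt
    have h2 := (s' j).isLt
    rw [Fin.ext_iff]
    omega
  exact ⟨funext fun j => (h1 j).1, funext fun j => (h1 j).2⟩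

theorem sum_refine {d : ℕ} (M : Finset (Cell d)) (f : Cell d → ℝ) :
    ∑ C ∈ Discretization.refine M, f C = ∑ K ∈ M, ∑ s, f (childCell K s) := by
  rw [Discretization.refine, Finset.sum_biUnion]
  · refine Finset.sum_congr rfl fun K _ => ?_
    rw [Finset.sum_image]
    · rfl
    · intro s _ s' _ h
      exact (childCell_inj h).2
  · intro K _ K' _ hne
    rw [Function.onFun, Finset.disjoint_left]
    intro C hC hC'
    simp only [Finset.mem_image, Finset.mem_univ, true_and] at hC hC'
    obtain ⟨s, rfl⟩ := hC
    obtain ⟨s', h⟩ := hC'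
    exact hne (childCell_inj h).1.symm

theorem childCell_mem_refine {d : ℕ} {M : Finset (Cell d)} {K : Cell d} (hK : K ∈ M)
    (s : Fin d → Fin 2) : childCell K s ∈ Discretization.refine M :=
  Finset.mem_biUnion.2 ⟨K, hK, Finset.mem_image.2 ⟨s, Finset.mem_univ s, rfl⟩⟩

theorem mem_refine {d : ℕ} {M : Finset (Cell d)} {C : Cell d} :
    C ∈ Discretization.refine M ↔ ∃ K ∈ M, ∃ s, childCell K s = C := by
  simp [Discretization.refine]
  rfl

/-! ### Facets of the refined mesh, assembly, and synthesis from hierarchical coefficients -/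

namespace Discretization

variable {d : ℕ} (D : Discretization d)

theorem mem_facets {M : Finset (Cell d)} {f : Facet d} :
    f ∈ D.facets M ↔ ∃ K ∈ M, ∃ p, D.facetOf K p = f := by
  simp [facets]

theorem facetOf_mem_facets {M : Finset (Cell d)} {K : Cell d} (hK : K ∈ M) (p : Fin d × Fin 2) :
    D.facetOf K p ∈ D.facets M := D.mem_facets.2 ⟨K, hK, p, rfl⟩

theorem facetOf_injective (K : Cell d) : Function.Injective (D.facetOf K) := by
  rintro ⟨i, t⟩ ⟨i', t'⟩ h
  simp only [facetOf, Prod.mk.injEq] at h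
  obtain ⟨rfl, h⟩ := h
  have := congrFun h (D.axis i)
  simp only [if_true, add_right_inj, Nat.cast_inj] at this
  rw [Fin.ext this]

theorem assemble_form (A : Cell d → Matrix (Fin d × Fin 2) (Fin d × Fin 2) ℝ) (M : Finset (Cell d))
    (x y : Facet d → ℝ) :
    (fun f : D.facets M => x f) ⬝ᵥ D.assemble A M *ᵥ (fun f : D.facets M => y f) =
      ∑ K ∈ M, ∑ p, ∑ q, A K p q * x (D.facetOf K p) * y (D.facetOf K q) := by
  have h : ∀ K ∈ M, ∀ p q, ∑ f : D.facets M, ∑ g : D.facets M,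
      x f * ((if D.facetOf K p = f ∧ D.facetOf K q = g then A K p q else 0) * y g) =
      A K p q * x (D.facetOf K p) * y (D.facetOf K q) := by
    intro K hK p q
    rw [Finset.sum_eq_single (⟨_, D.facetOf_mem_facets hK p⟩ : D.facets M),
      Finset.sum_eq_single (⟨_, D.facetOf_mem_facets hK q⟩ : D.facets M)]
    · simp [mul_left_comm, mul_assoc]
    · intro g _ hg
      rw [if_neg fun h => hg (Subtype.ext h.2.symm)]; simp
    · intro h; exact absurd (Finset.mem_univ _) h
    · intro f _ hf
      refine Finset.sum_eq_zero fun g _ => ?_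
      rw [if_neg fun h => hf (Subtype.ext h.1.symm)]; simp
    · intro h; exact absurd (Finset.mem_univ _) h
  rw [Finset.sum_congr rfl fun K hK => Finset.sum_congr rfl fun p _ => Finset.sum_congr rfl
    fun q _ => (h K hK p q).symm]
  simp only [dotProduct, Matrix.mulVec, assemble, Finset.sum_mul, Finset.mul_sum]
  rw [Finset.sum_congr rfl fun f _ => Finset.sum_comm, Finset.sum_comm]
  refine Finset.sum_congr rfl fun K _ => ?_
  rw [Finset.sum_congr rfl fun f _ => Finset.sum_comm, Finset.sum_comm]
  refine Finset.sum_congr rfl fun p _ => ?_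
  rw [Finset.sum_congr rfl fun f _ => Finset.sum_comm, Finset.sum_comm]

/-- The values of `x` on the children of the macro element `K`. -/
def macroValues (x : Facet d → ℝ) (K : Cell d) : MacroVec d := fun s i =>
  (x (D.facetOf (childCell K s) (i, s (D.axis i))),
    x (D.facetOf (childCell K s) (i, 1 - s (D.axis i))))

theorem facetOf_childCell_mirror (K : Cell d) (s : Fin d → Fin 2) (i : Fin d) :
    D.facetOf (childCell K (mirror (D.axis i) s)) (i, 1 - mirror (D.axis i) s (D.axis i)) =
      D.facetOf (childCell K s) (i, 1 - s (D.axis i)) := by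
  simp only [facetOf, Prod.mk.injEq, true_and]
  funext j
  by_cases hj : j = D.axis i
  · subst hj
    simp only [childCell, mirror, Function.update_self, if_true]
    generalize s (D.axis i) = t
    fin_cases t <;> simp
  · simp [childCell, mirror, hj]

theorem macroConforming_macroValues (x : Facet d → ℝ) (K : Cell d) :
    MacroConforming D.axis (D.macroValues x K) := by
  intro s i
  simp only [macroValues]
  rw [facetOf_childCell_mirror]

variable {σ : Fin d → ℝ} {a b c r : ℝ}

/-- The matrix is the rank-one matrix of 6 times the squared signed jump plus a rest supported in
the diagonal blocks, with `a - 6` and `b + 6`. Here `s` only decides which member of each pair is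
listed first; on a child this is the one on the macro boundary. -/
theorem blockPattern_form (hσ : ∀ i, σ i * σ i = 1) (hc : ∀ i j, i ≠ j → c = 6 * σ i * σ j)
    (x y : Fin d × Fin 2 → ℝ) (s : Fin d → Fin 2) :
    ∑ p, ∑ q, blockPattern d a b c p q * x p * y q =
    (∑ i, ((a - 6) * (x (i, s i) * y (i, s i) + x (i, 1 - s i) * y (i, 1 - s i))
      + (b + 6) * (x (i, s i) * y (i, 1 - s i) + x (i, 1 - s i) * y (i, s i))))
      + 6 * (∑ i, σ i * childSign s i * (x (i, 1 - s i) - x (i, s i)))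
        * ∑ i, σ i * childSign s i * (y (i, 1 - s i) - y (i, s i)) := by
  simp only [Fintype.sum_prod_type]
  have h : ∀ i j, ∑ t, ∑ t', blockPattern d a b c (i, t) (j, t') * x (i, t) * y (j, t') =
      (if i = j then ((a - 6) * (x (i, s i) * y (i, s i) + x (i, 1 - s i) * y (i, 1 - s i))
      + (b + 6) * (x (i, s i) * y (i, 1 - s i) + x (i, 1 - s i) * y (i, s i))) else 0) +
      6 * ((σ i * childSign s i * (x (i, 1 - s i) - x (i, s i))) *
        (σ j * childSign s j * (y (j, 1 - s j) - y (j, s j)))) := by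
    intro i j
    by_cases hij : i = j
    · subst hij
      have h1 := hσ i
      have h2 := childSign_mul_self s i
      rw [if_pos rfl]
      generalize childSign s i = ε at *
      generalize s i = t
      simp only [blockPattern, if_true]
      trans (a - 6) * (x (i, t) * y (i, t) + x (i, 1 - t) * y (i, 1 - t)) +
        (b + 6) * (x (i, t) * y (i, 1 - t) + x (i, 1 - t) * y (i, t)) +
        6 * (1 * 1 * (x (i, 1 - t) - x (i, t)) * (y (i, 1 - t) - y (i, t)))
      · fin_cases t <;> simp [Fin.sum_univ_two] <;> ring
      · linear_combination (-6 * (x (i, 1 - t) - x (i, t)) * (y (i, 1 - t) - y (i, t))) *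
          (ε * ε * h1 + h2)
    · rw [if_neg hij, zero_add]
      simp only [childSign, blockPattern, if_neg hij, hc i j hij]
      generalize s i = t
      generalize s j = t'
      fin_cases t <;> fin_cases t' <;> simp [Fin.sum_univ_two] <;> ring
  rw [Finset.sum_congr rfl fun i _ => Finset.sum_comm]
  simp only [h, Finset.sum_add_distrib, Finset.sum_ite_eq, Finset.mem_univ, if_true]
  congr 1
  rw [mul_assoc, Finset.sum_mul_sum]
  simp only [Finset.mul_sum]

theorem refined_form (hσ : ∀ i, σ i * σ i = 1) (hc : ∀ i j, i ≠ j → c = 6 * σ i * σ j)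
    (M : Finset (Cell d)) (x y : Facet d → ℝ) :
    (fun f : D.facets (refine M) => x f) ⬝ᵥ
      D.assemble (fun _ => r • blockPattern d a b c) (refine M) *ᵥ
        (fun f : D.facets (refine M) => y f) =
      r * ∑ K ∈ M, macroForm a b σ D.axis (D.macroValues x K) (D.macroValues y K) := by
  rw [assemble_form, sum_refine, Finset.mul_sum]
  refine Finset.sum_congr rfl fun K _ => ?_
  rw [macroForm_apply, Finset.mul_sum]
  refine Finset.sum_congr rfl fun s _ => ?_
  have h := blockPattern_form (a := a) (b := b) hσ hc
    (fun p => x (D.facetOf (childCell K s) p)) (fun p => y (D.facetOf (childCell K s) p))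
    (fun i => s (D.axis i))
  refine Eq.trans ?_ (congrArg (r * ·) h)
  simp only [Finset.mul_sum, Matrix.smul_apply, smul_eq_mul, mul_assoc]

/-- The coarse facet that contains the facet `g` of the refined mesh. -/
def parent (g : Facet d) : Facet d := (g.1, fun j => g.2 j / 2)

theorem isChild_iff {F g : Facet d} :
    D.IsChild F g ↔ Even (g.2 (D.axis g.1)) ∧ F = parent g := by
  obtain ⟨i, n⟩ := g
  obtain ⟨i', m⟩ := F
  simp only [IsChild, parent, Prod.mk.injEq]
  constructor
  · rintro ⟨rfl, h1, h2⟩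
    refine ⟨by rw [h1]; simp, rfl, funext fun j => ?_⟩
    by_cases hj : j = D.axis i
    · subst hj; omega
    · have := h2 j hj; omega
  · rintro ⟨h1, rfl, rfl⟩
    refine ⟨rfl, ?_, fun j _ => ?_⟩
    · obtain ⟨m, hm⟩ := h1
      simp only
      omega
    · simp only
      omega

/-- The function with the interior values `w`, the differences `u`, and the aggregates `v`. -/
def hierField (w : Facet d → ℝ) (u : Facet d × Finset (Fin d) → ℝ) (v : Facet d → ℝ) :
    Facet d → ℝ := fun g =>
  if Odd (g.2 (D.axis g.1)) then w g else
    1 / 2 ^ (d - 1) * (v (parent g) +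
      ∑ S with S.Nonempty ∧ D.axis g.1 ∉ S, u (parent g, S) *
        ∏ j ∈ S, if Even (g.2 j) then (1 : ℝ) else -1)

theorem even_axis_facetOf (K : Cell d) (s : Fin d → Fin 2) (i : Fin d) :
    Even ((D.facetOf (childCell K s) (i, s (D.axis i))).2
      (D.axis (D.facetOf (childCell K s) (i, s (D.axis i))).1)) := by
  simp only [facetOf, childCell, if_true, add_assoc]
  exact (even_two_mul _).add ⟨_, rfl⟩

theorem odd_axis_facetOf (K : Cell d) (s : Fin d → Fin 2) (i : Fin d) :
    Odd ((D.facetOf (childCell K s) (i, 1 - s (D.axis i))).2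
      (D.axis (D.facetOf (childCell K s) (i, 1 - s (D.axis i))).1)) := by
  simp only [facetOf, childCell, if_true, add_assoc]
  generalize s (D.axis i) = t
  fin_cases t <;> simp

theorem parent_facetOf (K : Cell d) (s : Fin d → Fin 2) (i : Fin d) :
    parent (D.facetOf (childCell K s) (i, s (D.axis i))) = D.facetOf K (i, s (D.axis i)) := by
  simp only [parent, facetOf, childCell, Prod.mk.injEq, true_and]
  funext j
  have := (s j).isLt
  by_cases hj : j = D.axis i
  · subst hj; simp only [if_true]; omega
  · simp only [if_neg hj]; omega

theorem exists_facetOf_childCell {M : Finset (Cell d)} {g : Facet d}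
    (hg : g ∈ D.facets (refine M)) : ∃ K ∈ M, ∃ s i, g = D.facetOf (childCell K s) (i, s (D.axis i)) ∨
      g = D.facetOf (childCell K s) (i, 1 - s (D.axis i)) := by
  obtain ⟨C, hC, ⟨i, t⟩, rfl⟩ := D.mem_facets.1 hg
  obtain ⟨K, hK, s, rfl⟩ := mem_refine.1 hC
  refine ⟨K, hK, s, i, ?_⟩
  have : t = s (D.axis i) ∨ t = 1 - s (D.axis i) := by
    generalize s (D.axis i) = t'
    fin_cases t <;> fin_cases t' <;> simp
  rcases this with rfl | rfl
  · exact Or.inl rfl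
  · exact Or.inr rfl

theorem parent_mem {M : Finset (Cell d)} {g : Facet d} (hg : g ∈ D.facets (refine M))
    (h : ¬ Odd (g.2 (D.axis g.1))) : parent g ∈ D.facets M := by
  obtain ⟨K, hK, s, i, rfl | rfl⟩ := D.exists_facetOf_childCell hg
  · rw [parent_facetOf]; exact D.facetOf_mem_facets hK _
  · exact absurd (D.odd_axis_facetOf K s i) h

theorem macroValues_hierField_fst (w : Facet d → ℝ) (u : Facet d × Finset (Fin d) → ℝ)
    (v : Facet d → ℝ) (K : Cell d) (s : Fin d → Fin 2) (i : Fin d) :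
    (D.macroValues (D.hierField w u v) K s i).1 = 1 / 2 ^ (d - 1) *
      (v (D.facetOf K (i, s (D.axis i))) + ∑ S with S.Nonempty ∧ D.axis i ∉ S,
        u (D.facetOf K (i, s (D.axis i)), S) * ∏ j ∈ S, childSign s j) := by
  simp only [macroValues, hierField]
  rw [if_neg (Int.not_odd_iff_even.2 (D.even_axis_facetOf K s i)), parent_facetOf]
  congr 2
  refine Finset.sum_congr rfl fun S hS => ?_
  congr 1
  refine Finset.prod_congr rfl fun j hj => ?_
  have hj' : j ≠ D.axis i := by
    rintro rfl
    exact (Finset.mem_filter.1 hS).2.2 hj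
  simp only [facetOf, childCell, if_neg hj', childSign, add_zero]
  generalize s j = t
  fin_cases t <;> simp

theorem macroValues_hierField_snd (w : Facet d → ℝ) (u : Facet d × Finset (Fin d) → ℝ)
    (v : Facet d → ℝ) (K : Cell d) (s : Fin d → Fin 2) (i : Fin d) :
    (D.macroValues (D.hierField w u v) K s i).2 =
      w (D.facetOf (childCell K s) (i, 1 - s (D.axis i))) := by
  simp only [macroValues, hierField]
  rw [if_pos (D.odd_axis_facetOf K s i)]

/-- The coefficient vector of `hierField w u v` in the hierarchical basis. -/
def hierVec (M : Finset (Cell d)) (w : Facet d → ℝ) (u : Facet d × Finset (Fin d) → ℝ)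
    (v : Facet d → ℝ) : D.interiorFacets M ⊕ (D.differences M ⊕ D.facets M) → ℝ :=
  Sum.elim (fun f => w f) (Sum.elim (fun q => u q) fun F => v F)

/-- Turns matrix algebra into functions on facets: quadratic forms of `J A Jᵀ` become energies of
`hierField`. -/
theorem J_transpose_mulVec (M : Finset (Cell d)) (w : Facet d → ℝ)
    (u : Facet d × Finset (Fin d) → ℝ) (v : Facet d → ℝ) :
    (D.J M)ᵀ *ᵥ D.hierVec M w u v = fun g : D.facets (refine M) => D.hierField w u v g := by
  funext g
  obtain ⟨g, hg⟩ := g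
  have hint : ∑ f : D.interiorFacets M, (if (f : Facet d) = g then w f else 0) =
      if Odd (g.2 (D.axis g.1)) then w g else 0 := by
    rw [Finset.sum_coe_sort (D.interiorFacets M) fun f => if f = g then w f else 0]
    simp [interiorFacets, hg]
  have hagg : ∑ F : D.facets M, (if D.IsChild F g then 1 / 2 ^ (d - 1) * v F else 0) =
      if Odd (g.2 (D.axis g.1)) then 0 else 1 / 2 ^ (d - 1) * v (parent g) := by
    rw [Finset.sum_coe_sort (D.facets M) fun F =>
      if D.IsChild F g then 1 / 2 ^ (d - 1) * v F else 0]
    split_ifs with h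
    · refine Finset.sum_eq_zero fun F _ => if_neg fun hF => ?_
      exact Int.not_even_iff_odd.2 h (D.isChild_iff.1 hF).1
    · simp only [D.isChild_iff, Int.not_odd_iff_even.1 h, true_and, Finset.sum_ite_eq',
        D.parent_mem hg h, if_true]
  have hdiff : ∑ q : D.differences M, (if D.IsChild q.1.1 g then 1 / 2 ^ (d - 1) * (u q *
      ∏ j ∈ q.1.2, if Even (g.2 j) then (1 : ℝ) else -1) else 0) =
      if Odd (g.2 (D.axis g.1)) then 0 else
        1 / 2 ^ (d - 1) * ∑ S with S.Nonempty ∧ D.axis g.1 ∉ S, u (parent g, S) *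
        ∏ j ∈ S, if Even (g.2 j) then (1 : ℝ) else -1 := by
    rw [Finset.sum_coe_sort (D.differences M) fun q => if D.IsChild q.1 g then
      1 / 2 ^ (d - 1) * (u q * ∏ j ∈ q.2, if Even (g.2 j) then (1 : ℝ) else -1) else 0]
    split_ifs with h
    · refine Finset.sum_eq_zero fun F _ => if_neg fun hF => ?_
      exact Int.not_even_iff_odd.2 h (D.isChild_iff.1 hF).1
    · simp only [D.isChild_iff, Int.not_odd_iff_even.1 h, true_and]
      rw [differences, Finset.sum_filter, Finset.sum_product, Finset.sum_eq_single (parent g)]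
      · rw [Finset.mul_sum, Finset.sum_filter]
        simp [parent]
      · intro F _ hF
        simp [hF]
      · intro h'
        exact absurd (D.parent_mem hg h) h'
  simp only [J, hierVec, Matrix.mulVec, dotProduct, Fintype.sum_sum_type, Matrix.transpose_apply,
    Matrix.fromRows_apply_inl, Matrix.fromRows_apply_inr, Sum.elim_inl, Sum.elim_inr, Jint, Jdiff,
    Jagg, ite_mul, one_mul, zero_mul, hint, hagg]
  simp only [mul_assoc, mul_comm (Finset.prod _ _), hdiff, hierField]
  split_ifs
  · simp
  · ring

theorem hier_form (hσ : ∀ i, σ i * σ i = 1) (hc : ∀ i j, i ≠ j → c = 6 * σ i * σ j)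
    (M : Finset (Cell d)) (w w' : Facet d → ℝ) (u u' : Facet d × Finset (Fin d) → ℝ)
    (v v' : Facet d → ℝ) :
    D.hierVec M w' u' v' ⬝ᵥ
      D.hier M (D.assemble (fun _ => r • blockPattern d a b c) (refine M)) *ᵥ D.hierVec M w u v =
      r * ∑ K ∈ M, macroForm a b σ D.axis (D.macroValues (D.hierField w' u' v') K)
        (D.macroValues (D.hierField w u v) K) := by
  rw [hier, ← Matrix.mulVec_mulVec, ← Matrix.mulVec_mulVec, Matrix.dotProduct_mulVec,
    ← Matrix.mulVec_transpose, J_transpose_mulVec, J_transpose_mulVec, refined_form D hσ hc]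

end Discretization

/-- Extension by zero of a function on a finite set. -/
def extendZero {ι : Type*} [DecidableEq ι] {A : Finset ι} (f : A → ℝ) : ι → ℝ :=
  fun x => if h : x ∈ A then f ⟨x, h⟩ else 0

theorem extendZero_coe {ι : Type*} [DecidableEq ι] {A : Finset ι} (f : A → ℝ) (x : A) :
    extendZero f x = f x := by
  simp [extendZero]

/-! ### Static condensation as energy orthogonality -/

namespace Discretization

variable {d : ℕ} (D : Discretization d) {σ : Fin d → ℝ} {a b c r : ℝ}

/-- The global energy form, up to a factor. -/
def meshForm (a b : ℝ) (σ : Fin d → ℝ) (M : Finset (Cell d)) (x y : Facet d → ℝ) : ℝ :=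
  ∑ K ∈ M, macroForm a b σ D.axis (D.macroValues x K) (D.macroValues y K)

/-- The function is orthogonal to all functions supported on the interior facets. -/
def IsHarmonic (a b : ℝ) (σ : Fin d → ℝ) (M : Finset (Cell d)) (x : Facet d → ℝ) : Prop :=
  ∀ w, D.meshForm a b σ M (D.hierField w 0 0) x = 0

theorem eq_zero_of_interior_energy (hab : 0 < a + b) (hab' : 12 < a - b)
    {M : Finset (Cell d)} {w : Facet d → ℝ}
    (h : D.meshForm a b σ M (D.hierField w 0 0) (D.hierField w 0 0) = 0)
    (f : D.interiorFacets M) : w f = 0 := by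
  obtain ⟨f, hf⟩ := f
  obtain ⟨hf1, hf2⟩ := Finset.mem_filter.1 hf
  obtain ⟨K, hK, s, i, rfl | rfl⟩ := D.exists_facetOf_childCell hf1
  · exact absurd hf2 (Int.not_odd_iff_even.2 (D.even_axis_facetOf K s i))
  · have h1 := (Finset.sum_eq_zero_iff_of_nonneg
      fun K _ => macroForm_self_nonneg hab hab' _).1 h K hK
    have h2 := eq_zero_of_macroForm_self hab hab' h1
    have h3 := congrArg Prod.snd (congrFun (congrFun h2 s) i)
    rwa [macroValues_hierField_snd] at h3

theorem isUnit_interior (hσ : ∀ i, σ i * σ i = 1) (hc : ∀ i j, i ≠ j → c = 6 * σ i * σ j)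
    (hab : 0 < a + b) (hab' : 12 < a - b) (hr : 0 < r) (M : Finset (Cell d)) :
    IsUnit (D.hier M
      (D.assemble (fun _ => r • blockPattern d a b c) (refine M))).toBlocks₁₁.det := by
  refine isUnit_det_of_form_pos _ fun w hw => ?_
  set H := D.hier M (D.assemble (fun _ => r • blockPattern d a b c) (refine M)) with hH
  have hv : D.hierVec M (extendZero w) 0 0 = Sum.elim w 0 := by
    funext z
    rcases z with z | z | z
    · exact extendZero_coe w z
    · rfl
    · rfl
  have h1 := D.hier_form (r := r) (a := a) (b := b) hσ hc M (extendZero w) (extendZero w) 0 0 0 0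
  rw [hv, ← hH] at h1
  have h2 : Sum.elim w 0 ⬝ᵥ H *ᵥ Sum.elim w 0 = w ⬝ᵥ H.toBlocks₁₁ *ᵥ w := by
    conv_lhs => rw [← Matrix.fromBlocks_toBlocks H, Matrix.fromBlocks_mulVec]
    simp
  rw [h2, hw] at h1
  have h3 := (mul_eq_zero.1 h1.symm).resolve_left hr.ne'
  funext f
  rw [← extendZero_coe w f]
  exact D.eq_zero_of_interior_energy hab hab' h3 f

/-- Harmonicity on one side is enough: the interior rows of the right vector vanish, so the interior
values `w'` on the left are free. Hence a Schur complement entry can be computed from any convenient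
extension of the left argument. -/
theorem condensed_form (hσ : ∀ i, σ i * σ i = 1) (hc : ∀ i j, i ≠ j → c = 6 * σ i * σ j)
    (hab : 0 < a + b) (hab' : 12 < a - b) (hr : 0 < r) (M : Finset (Cell d))
    (w w' : Facet d → ℝ) (u u' : Facet d × Finset (Fin d) → ℝ) (v v' : Facet d → ℝ)
    (h : D.IsHarmonic a b σ M (D.hierField w u v)) :
    Sum.elim (fun q : D.differences M => u' q) (fun F : D.facets M => v' F) ⬝ᵥ
      D.condensed M (D.assemble (fun _ => r • blockPattern d a b c) (refine M)) *ᵥ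
        Sum.elim (fun q : D.differences M => u q) (fun F : D.facets M => v F) =
      r * D.meshForm a b σ M (D.hierField w' u' v') (D.hierField w u v) := by
  classical
  have hf := fun w' u' v' => D.hier_form (r := r) (a := a) (b := b) hσ hc M w w' u u' v v'
  have hU := D.isUnit_interior hσ hc hab hab' hr M
  rw [condensed]
  set H := D.hier M (D.assemble (fun _ => r • blockPattern d a b c) (refine M)) with hH
  have hst : ∀ i, (H *ᵥ D.hierVec M w u v) (Sum.inl i) = 0 := by
    intro i
    -- Testing with a single interior facet reads off one row of the residual.
    have h1 := hf (Pi.single (i : Facet d) 1) 0 0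
    have h2 : D.hierVec M (Pi.single (i : Facet d) 1) 0 0 = Pi.single (Sum.inl i) 1 := by
      funext z
      rcases z with z | z | z
      · by_cases hz : z = i
        · subst hz; simp [hierVec]
        · simp [hierVec, hz, Pi.single_apply]
      · simp [hierVec]
      · simp [hierVec]
    rw [h2, single_one_dotProduct] at h1
    rw [h1, show ∑ K ∈ M, _ = (0 : ℝ) from h _, mul_zero]
  rw [schur_mulVec H hU _ _ hst]
  refine Eq.trans ?_ (hf w' u' v')
  conv_rhs => rw [dotProduct, Fintype.sum_sum_type]
  rw [Finset.sum_eq_zero fun i _ => by rw [hst i, mul_zero], zero_add]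
  rfl

theorem exists_harmonic (hσ : ∀ i, σ i * σ i = 1) (hc : ∀ i j, i ≠ j → c = 6 * σ i * σ j)
    (hab : 0 < a + b) (hab' : 12 < a - b) (M : Finset (Cell d))
    (u : Facet d × Finset (Fin d) → ℝ) (v : Facet d → ℝ) :
    ∃ w, D.IsHarmonic a b σ M (D.hierField w u v) := by
  have hU := D.isUnit_interior hσ hc hab hab' one_pos M
  obtain ⟨w, hw⟩ := exists_stationary _ hU
    (Sum.elim (fun q : D.differences M => u q) (fun F : D.facets M => v F))
  refine ⟨extendZero w, fun w' => ?_⟩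
  have h1 := D.hier_form (r := 1) (a := a) (b := b) hσ hc M (extendZero w) w' u 0 v 0
  have hv : D.hierVec M (extendZero w) u v = Sum.elim w
      (Sum.elim (fun q : D.differences M => u q) (fun F : D.facets M => v F)) := by
    funext z
    rcases z with z | z
    · exact extendZero_coe w z
    · rfl
  rw [hv, one_mul] at h1
  refine h1.symm.trans ?_
  rw [dotProduct, Fintype.sum_sum_type, Finset.sum_eq_zero fun i _ => by rw [hw i, mul_zero],
    zero_add]
  refine Finset.sum_eq_zero fun k _ => ?_
  rcases k with k | k <;> simp [hierVec]

/-! ## The harmonic extension of coarse functions -/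

/-- The sum of the values of `v` on the two facets of type `i` of `K`. -/
def pairSum (v : Facet d → ℝ) (K : Cell d) (i : Fin d) : ℝ :=
  v (D.facetOf K (i, 0)) + v (D.facetOf K (i, 1))

/-- Half the difference of the values of `v` on the two facets of type `i` of `K`. -/
def pairDiff (v : Facet d → ℝ) (K : Cell d) (i : Fin d) : ℝ :=
  (v (D.facetOf K (i, 1)) - v (D.facetOf K (i, 0))) / 2

/-- The interior values that are proportional to the sums of the adjacent aggregates. -/
def interiorField (l : ℝ) (v : Facet d → ℝ) : Facet d → ℝ := fun g =>
  1 / 2 ^ (d - 1) * (l * D.pairSum v (fun j => g.2 j / 2) g.1)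

theorem interiorField_apply (l : ℝ) (v : Facet d → ℝ) (K : Cell d) (s : Fin d → Fin 2) (i : Fin d) :
    D.interiorField l v (D.facetOf (childCell K s) (i, 1 - s (D.axis i))) =
      1 / 2 ^ (d - 1) * (l * D.pairSum v K i) := by
  have : (fun j => (D.facetOf (childCell K s) (i, 1 - s (D.axis i))).2 j / 2) = K := by
    funext j
    have := (s j).isLt
    simp only [facetOf, childCell]
    by_cases hj : j = D.axis i
    · subst hj
      simp only [if_true]
      generalize s (D.axis i) = t
      fin_cases t <;> simp <;> omega
    · simp only [if_neg hj]; omega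
  rw [interiorField, this]
  rfl

/-- The global minimizer with zero differences restricts to the local minimizer on each macro
element, up to the factor of the hierarchical basis. -/
theorem macroValues_harmonic (v : Facet d → ℝ) (K : Cell d) :
    D.macroValues (D.hierField (D.interiorField (-b / (2 * a)) v) 0 v) K =
      (1 / 2 ^ (d - 1) : ℝ) •
        harmonicTrial a b σ D.axis (D.pairSum v K) (D.pairDiff v K) := by
  funext s i
  refine Prod.ext ?_ ?_
  · rw [macroValues_hierField_fst]
    simp only [Pi.zero_apply, zero_mul, Finset.sum_const_zero, add_zero, harmonicTrial, macroTrial,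
      Pi.smul_apply, Prod.smul_fst, smul_eq_mul, pairSum, pairDiff, childSign]
    generalize s (D.axis i) = t
    fin_cases t <;> simp <;> ring_nf
  · rw [macroValues_hierField_snd, interiorField_apply]
    rfl

theorem macroValues_interior_fst (w : Facet d → ℝ) (K : Cell d) (s : Fin d → Fin 2) (i : Fin d) :
    (D.macroValues (D.hierField w 0 0) K s i).1 = 0 := by
  rw [macroValues_hierField_fst]; simp

theorem isHarmonic_harmonic (hσ : ∀ i, σ i * σ i = 1) (hπ : Function.Injective D.axis)
    (ha : a ≠ 0) (M : Finset (Cell d)) (v : Facet d → ℝ) :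
    D.IsHarmonic a b σ M (D.hierField (D.interiorField (-b / (2 * a)) v) 0 v) := by
  intro w
  refine Finset.sum_eq_zero fun K _ => ?_
  rw [D.macroValues_harmonic (σ := σ), map_smul, harmonicTrial,
    macroForm_macroTrial_of_interior hσ hπ (harmonic_balance ha)
    (D.macroConforming_macroValues _ K) (D.macroValues_interior_fst w K), smul_zero]

/-- The harmonic extension is explicit on each cell, so the coarse energy is a sum of local ones. In
the new parameters, a' + b' = 2(a + b)(a - b)/a governs the `S` part and a' - b' = 2a, with
unchanged `c`, the `E` part. -/
theorem coarse_assemble (hσ : ∀ i, σ i * σ i = 1) (hc : ∀ i j, i ≠ j → c = 6 * σ i * σ j)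
    (hπ : Function.Injective D.axis) (hd : 1 ≤ d) (hab : 0 < a + b) (hab' : 12 < a - b)
    (hr : 0 < r) (M : Finset (Cell d)) :
    D.coarse M (D.assemble (fun _ => r • blockPattern d a b c) (refine M)) =
      D.assemble (fun _ => (r / 2 ^ d) • blockPattern d (2 * a + -b ^ 2 / a) (-b ^ 2 / a) c) M := by
  classical
  have ha : a ≠ 0 := by linarith
  ext F F'
  have hsingle : ∀ F : D.facets M,
      (fun f : D.facets M => (Pi.single (F : Facet d) 1 : Facet d → ℝ) f) = Pi.single F 1 := by
    intro F
    funext f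
    by_cases hf : f = F
    · subst hf; simp
    · simp [hf, Subtype.coe_injective.ne hf]
  -- Entries are compared by inserting the unit vectors of two coarse facets.
  have hL := D.condensed_form hσ hc hab hab' hr M
    (D.interiorField (-b / (2 * a)) (Pi.single (F' : Facet d) 1))
    (D.interiorField (-b / (2 * a)) (Pi.single (F : Facet d) 1)) 0 0
    (Pi.single (F' : Facet d) 1) (Pi.single (F : Facet d) 1)
    (D.isHarmonic_harmonic hσ hπ ha M _)
  have hR := D.assemble_form
    (fun _ => (r / 2 ^ d) • blockPattern d (2 * a + -b ^ 2 / a) (-b ^ 2 / a) c) M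
    (Pi.single (F : Facet d) 1) (Pi.single (F' : Facet d) 1)
  have hel : ∀ F : D.facets M, (Sum.elim (fun q : D.differences M =>
      (0 : Facet d × Finset (Fin d) → ℝ) q) (Pi.single F 1 : D.facets M → ℝ)) =
      Pi.single (Sum.inr F) 1 := by
    intro F
    funext z
    rcases z with z | z <;> simp [Pi.single_apply]
  rw [hsingle, hsingle, single_one_dotProduct, Matrix.mulVec_single_one, Matrix.col_apply] at hR
  rw [hsingle, hsingle, hel, hel, single_one_dotProduct, Matrix.mulVec_single_one,
    Matrix.col_apply] at hL
  rw [hR]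
  refine hL.trans ?_
  rw [meshForm, Finset.mul_sum]
  refine Finset.sum_congr rfl fun K _ => ?_
  generalize (Pi.single (F : Facet d) 1 : Facet d → ℝ) = v'
  generalize (Pi.single (F' : Facet d) 1 : Facet d → ℝ) = v
  -- The choice `s = 0` lists the lower facet first, so the jumps become 2 Σ σ_i E_i.
  have hp := blockPattern_form (a := 2 * a + -b ^ 2 / a) (b := -b ^ 2 / a) hσ hc
    (fun p => v' (D.facetOf K p)) (fun p => v (D.facetOf K p)) 0
  have hp' : ∑ p, ∑ q, ((r / 2 ^ d) • blockPattern d (2 * a + -b ^ 2 / a) (-b ^ 2 / a) c) p q *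
      v' (D.facetOf K p) * v (D.facetOf K q) = (r / 2 ^ d) *
      ∑ p, ∑ q, blockPattern d (2 * a + -b ^ 2 / a) (-b ^ 2 / a) c p q *
      v' (D.facetOf K p) * v (D.facetOf K q) := by
    simp only [Finset.mul_sum, Matrix.smul_apply, smul_eq_mul, mul_assoc]
  rw [hp', hp, D.macroValues_harmonic (σ := σ), D.macroValues_harmonic (σ := σ), map_smul, map_smul,
    LinearMap.smul_apply, macroForm_harmonic_harmonic hσ hπ ha]
  have h2 : (2 : ℝ) ^ d = 2 * 2 ^ (d - 1) := by
    rw [← pow_succ', Nat.sub_add_cancel hd]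
  have hj : ∀ v : Facet d → ℝ, ∑ i, σ i * childSign (0 : Fin d → Fin 2) i *
      (v (D.facetOf K (i, 1 - (0 : Fin d → Fin 2) i)) - v (D.facetOf K (i, (0 : Fin d → Fin 2) i))) =
      2 * ∑ i, σ i * D.pairDiff v K i := by
    intro v
    rw [Finset.mul_sum]
    refine Finset.sum_congr rfl fun i _ => ?_
    simp only [childSign, pairDiff, Pi.zero_apply, if_true, sub_zero]
    ring
  rw [hj, hj]
  generalize hC : ∑ i, σ i * D.pairDiff v K i = C
  rw [Finset.mul_sum (s := Finset.univ) (a := (2 : ℝ)),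
    Finset.mul_sum (s := Finset.univ) (a := (6 : ℝ)), Finset.sum_mul, ← Finset.sum_add_distrib,
    smul_eq_mul, smul_eq_mul, Finset.mul_sum, Finset.mul_sum, Finset.mul_sum, Finset.mul_sum,
    Finset.mul_sum]
  refine Finset.sum_congr rfl fun i _ => ?_
  simp only [pairSum, pairDiff, Pi.zero_apply, sub_zero, h2]
  field_simp
  ring

end Discretization

namespace Discretization

variable {d : ℕ} (D : Discretization d) {σ : Fin d → ℝ} {a b c r : ℝ}

/-! ## The CBS constant of an assembled matrix -/

/-- Each difference carries a nonempty `S` of directions along its facet. Reflection in some j ∈ S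
flips the sign product but keeps the side of the macro element, so sums over either side vanish. -/
theorem zeroAggregates_differences (w : Facet d → ℝ) (u : Facet d × Finset (Fin d) → ℝ)
    (K : Cell d) : ZeroAggregates D.axis (D.macroValues (D.hierField w u 0) K) := by
  have key : ∀ i (g : Fin 2 → ℝ), ∑ s, g (s (D.axis i)) *
      (D.macroValues (D.hierField w u 0) K s i).1 = 0 := by
    intro i g
    simp only [macroValues_hierField_fst, Pi.zero_apply, zero_add, Finset.mul_sum]
    rw [Finset.sum_comm]
    refine Finset.sum_eq_zero fun S hS => ?_
    obtain ⟨⟨j, hj⟩, hi⟩ := (Finset.mem_filter.1 hS).2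
    refine sum_eq_zero_of_mirror j fun s => ?_
    have hij : D.axis i ≠ j := fun h => hi (h ▸ hj)
    have h1 : mirror j s (D.axis i) = s (D.axis i) := by simp [mirror, hij]
    have h2 : ∏ k ∈ S, childSign (mirror j s) k = -∏ k ∈ S, childSign s k := by
      rw [← Finset.mul_prod_erase _ _ hj, ← Finset.mul_prod_erase _ (childSign s) hj,
        childSign_mirror_self, Finset.prod_congr rfl fun k hk =>
          childSign_mirror_of_ne s (Finset.ne_of_mem_erase hk)]
      ring
    rw [h1, h2]
    ring
  intro i
  refine ⟨?_, ?_⟩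
  · simpa using key i 1
  · exact key i fun t => if t = 0 then 1 else -1

theorem macroValues_hier_sq_le (hσ : ∀ i, σ i * σ i = 1) (hπ : Function.Injective D.axis)
    (hd : 1 ≤ d) (hab : 0 < a + b) (hab' : 12 < a - b)
    (w : Facet d → ℝ) (u : Facet d × Finset (Fin d) → ℝ) (v : Facet d → ℝ) (K : Cell d) :
    macroForm a b σ D.axis (D.macroValues (D.hierField w u 0) K)
      (D.macroValues (D.hierField (D.interiorField (-b / (2 * a)) v) 0 v) K) ^ 2 ≤
    cbsSq d a b * (macroForm a b σ D.axis (D.macroValues (D.hierField w u 0) K)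
        (D.macroValues (D.hierField w u 0) K) *
      macroForm a b σ D.axis
        (D.macroValues (D.hierField (D.interiorField (-b / (2 * a)) v) 0 v) K)
        (D.macroValues (D.hierField (D.interiorField (-b / (2 * a)) v) 0 v) K)) := by
  have h := macroForm_harmonic_sq_le hσ hπ hd hab hab' (D.macroConforming_macroValues _ K)
    (D.zeroAggregates_differences w u K) (D.pairSum v K) (D.pairDiff v K)
  rw [D.macroValues_harmonic (σ := σ), map_smul, map_smul, map_smul, LinearMap.smul_apply]
  simp only [smul_eq_mul]
  have h2 := mul_le_mul_of_nonneg_left h (sq_nonneg (1 / 2 ^ (d - 1) : ℝ))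
  refine le_of_eq_of_le (by ring) (h2.trans (le_of_eq (by ring)))

/-- The cellwise bounds have a common constant and are combined by Cauchy-Schwarz for the sum over
cells. -/
theorem meshForm_hier_le (hσ : ∀ i, σ i * σ i = 1) (hπ : Function.Injective D.axis)
    (hd : 1 ≤ d) (hab : 0 < a + b) (hab' : 12 < a - b) (M : Finset (Cell d))
    (w : Facet d → ℝ) (u : Facet d × Finset (Fin d) → ℝ) (v : Facet d → ℝ) :
    D.meshForm a b σ M (D.hierField w u 0)
      (D.hierField (D.interiorField (-b / (2 * a)) v) 0 v) ≤
    √(cbsSq d a b) * (√(D.meshForm a b σ M (D.hierField w u 0) (D.hierField w u 0)) *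
      √(D.meshForm a b σ M (D.hierField (D.interiorField (-b / (2 * a)) v) 0 v)
        (D.hierField (D.interiorField (-b / (2 * a)) v) 0 v))) := by
  have hg := cbsSq_nonneg (d := d) hd (by linarith : 6 < a) hab (by linarith)
  refine le_trans ?_ (mul_le_mul_of_nonneg_left (Real.sum_sqrt_mul_sqrt_le M
    (fun K => macroForm_self_nonneg (σ := σ) (π := D.axis) hab hab' _)
    (fun K => macroForm_self_nonneg hab hab' _)) (Real.sqrt_nonneg _))
  rw [meshForm, Finset.mul_sum]
  refine Finset.sum_le_sum fun K _ => ?_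
  rw [← Real.sqrt_mul (macroForm_self_nonneg hab hab' _), ← Real.sqrt_mul hg]
  exact Real.le_sqrt_of_sq_le (D.macroValues_hier_sq_le hσ hπ hd hab hab' w u v K)

/-! ### The checkerboard pair that attains the constant on every cell -/

/-- The sign `(-1)^(Σ n_j)` over all directions `j` along the facets of type `k`. -/
def checkerSign (k : Fin d) (n : Fin d → ℤ) : ℝ :=
  ∏ j ∈ Finset.univ.erase (D.axis k), if Even (n j) then (1 : ℝ) else -1

/-- The aggregates at which the CBS constant is attained. -/
def checkerAggregates (f : Facet d) : ℝ := D.checkerSign f.1 f.2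

/-- The differences at which the CBS constant is attained. -/
def checkerDifferences (a b : ℝ) (σ : Fin d → ℝ) (q : Facet d × Finset (Fin d)) : ℝ :=
  -(2 * diffAmplitude d a b * σ q.1.1) * ∑ k ∈ Finset.univ.erase q.1.1,
    if q.2 = {D.axis k} then σ k * D.checkerSign k q.1.2 else 0

theorem checkerSign_mul_self (k : Fin d) (n : Fin d → ℤ) :
    D.checkerSign k n * D.checkerSign k n = 1 := by
  rw [checkerSign, ← Finset.prod_mul_distrib]
  exact Finset.prod_eq_one fun j _ => by split_ifs <;> norm_num

theorem checkerAggregates_facetOf (K : Cell d) (i : Fin d) (t : Fin 2) :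
    D.checkerAggregates (D.facetOf K (i, t)) = D.checkerSign i K := by
  rw [checkerAggregates, checkerSign, checkerSign]
  refine Finset.prod_congr rfl fun j hj => ?_
  have : j ≠ D.axis i := Finset.ne_of_mem_erase hj
  simp [facetOf, this]

theorem pairSum_checkerAggregates (K : Cell d) (i : Fin d) :
    D.pairSum D.checkerAggregates K i = 2 * D.checkerSign i K := by
  rw [pairSum, checkerAggregates_facetOf, checkerAggregates_facetOf, two_mul]

theorem pairDiff_checkerAggregates (K : Cell d) :
    D.pairDiff D.checkerAggregates K = 0 := by
  funext i
  rw [pairDiff, checkerAggregates_facetOf, checkerAggregates_facetOf]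
  simp

/-- This makes the local optimizers fit together. From one cell to its neighbour across a facet of
type `i`, both ε_i and the checkerboard sign of type k ≠ i change, so the product depends on the
facet alone. -/
theorem checkerSign_facetOf (hπ : Function.Injective D.axis) (K : Cell d) (s : Fin d → Fin 2)
    {i k : Fin d} (hk : k ≠ i) :
    D.checkerSign k (D.facetOf K (i, s (D.axis i))).2 =
      childSign s (D.axis i) * D.checkerSign k K := by
  have hm : D.axis i ∈ Finset.univ.erase (D.axis k) :=
    Finset.mem_erase.2 ⟨hπ.ne hk.symm, Finset.mem_univ _⟩
  rw [checkerSign, checkerSign, ← Finset.mul_prod_erase _ _ hm,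
    ← Finset.mul_prod_erase _ (fun j => if Even (K j) then (1 : ℝ) else -1) hm, ← mul_assoc]
  congr 1
  · simp only [facetOf, if_true, childSign]
    generalize s (D.axis i) = t
    fin_cases t
    · simp
    · by_cases h : Even (K (D.axis i)) <;> simp [h, parity_simps]
  · refine Finset.prod_congr rfl fun j hj => ?_
    simp [facetOf, Finset.ne_of_mem_erase hj]

/-- Only the singletons S = {axis k} contribute, giving the products ε_i ε_k. The 2 in the amplitude
comes from S_k = ±2, and its minus sign from subtracting the orthogonal extension. -/
theorem macroValues_checker (hπ : Function.Injective D.axis) (K : Cell d) :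
    D.macroValues (D.hierField (D.interiorField (-b / (2 * a) -
        (1 / 2 + (d - 1) * diffAmplitude d a b + (a - 6) / 6 * diffAmplitude d a b))
        D.checkerAggregates) (D.checkerDifferences a b σ) 0) K =
      (1 / 2 ^ (d - 1) : ℝ) •
        differenceTrial a b σ D.axis (D.pairSum D.checkerAggregates K) 0 := by
  funext s i
  refine Prod.ext ?_ ?_
  · rw [macroValues_hierField_fst]
    simp only [Pi.zero_apply, zero_add, differenceTrial, harmonicTrial, orthogonalTrial, macroTrial,
      Pi.smul_apply, Pi.sub_apply, Prod.fst_sub, Prod.smul_fst, smul_eq_mul]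
    congr 1
    have h1 : ∀ S : Finset (Fin d),
        D.checkerDifferences a b σ (D.facetOf K (i, s (D.axis i)), S) * ∏ j ∈ S, childSign s j =
        -(2 * diffAmplitude d a b * σ i) * ∑ k ∈ Finset.univ.erase i,
          if S = {D.axis k} then childSign s (D.axis i) *
            (σ k * childSign s (D.axis k) * D.checkerSign k K) else 0 := by
      intro S
      rw [checkerDifferences, mul_assoc, Finset.sum_mul]
      congr 1
      refine Finset.sum_congr rfl fun k hk => ?_
      split_ifs with h
      · simp only at h
        rw [D.checkerSign_facetOf hπ K s (Finset.ne_of_mem_erase hk), h, Finset.prod_singleton]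
        ring
      · simp
    simp only [h1, ← Finset.mul_sum]
    rw [Finset.sum_comm]
    have h2 : ∀ k ∈ Finset.univ.erase i, (∑ S : Finset (Fin d) with S.Nonempty ∧ D.axis i ∉ S,
        if S = {D.axis k} then childSign s (D.axis i) *
            (σ k * childSign s (D.axis k) * D.checkerSign k K) else 0) =
        childSign s (D.axis i) * (σ k * childSign s (D.axis k) * D.checkerSign k K) := by
      intro k hk
      rw [Finset.sum_ite_eq', if_pos]
      simp [hπ.eq_iff, (Finset.ne_of_mem_erase hk).symm]
    rw [Finset.sum_congr rfl h2, ← Finset.mul_sum]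
    simp only [pairSum_checkerAggregates, mul_left_comm _ (2 : ℝ), ← Finset.mul_sum]
    ring
  · rw [macroValues_hierField_snd, interiorField_apply]
    simp only [differenceTrial, harmonicTrial, orthogonalTrial, macroTrial, Pi.smul_apply,
      Pi.sub_apply, Prod.snd_sub, Prod.smul_snd, smul_eq_mul]
    ring

/-- The value does not depend on the mesh: M = {G} gives the local constant, and any larger mesh
gives the same number globally. For d ≥ 2 the optimal differences are nonzero. -/
theorem isGreatest_cbsQuotients (hσ : ∀ i, σ i * σ i = 1) (hc : ∀ i j, i ≠ j → c = 6 * σ i * σ j)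
    (hπ : Function.Injective D.axis) (hd : 2 ≤ d) (hab : 0 < a + b) (hab' : 12 < a - b)
    (hr : 0 < r) {M : Finset (Cell d)} (hM : M.Nonempty) :
    IsGreatest (cbsQuotients
      (D.condensed M (D.assemble (fun _ => r • blockPattern d a b c) (refine M))))
      √(cbsSq d a b) := by
  have hd1 : 1 ≤ d := by omega
  have h6 : 6 < a := by linarith
  have ha : a ≠ 0 := by linarith
  have hl : ∀ u : Facet d × Finset (Fin d) → ℝ, Sum.elim (fun q : D.differences M => u q)
      (fun F : D.facets M => (0 : Facet d → ℝ) F) =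
      Sum.elim (fun q : D.differences M => u q) (0 : D.facets M → ℝ) := fun u => rfl
  have hr' : ∀ v : Facet d → ℝ, Sum.elim
      (fun q : D.differences M => (0 : Facet d × Finset (Fin d) → ℝ) q)
      (fun F : D.facets M => v F) =
      Sum.elim (0 : D.differences M → ℝ) (fun F : D.facets M => v F) := fun v => rfl
  have hext : ∀ v, D.IsHarmonic a b σ M (D.hierField (D.interiorField (-b / (2 * a)) v) 0 v) :=
    D.isHarmonic_harmonic hσ hπ ha M
  have hnn : ∀ x, 0 ≤ D.meshForm a b σ M x x := fun x =>
    Finset.sum_nonneg fun K _ => macroForm_self_nonneg hab hab' _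
  constructor
  · set v := D.checkerAggregates with hv
    set u := D.checkerDifferences a b σ with hu
    set w := D.interiorField (-b / (2 * a) -
        (1 / 2 + (d - 1) * diffAmplitude d a b + (a - 6) / 6 * diffAmplitude d a b)) v with hw
    have hY : D.IsHarmonic a b σ M (D.hierField w u 0) := by
      intro w'
      refine Finset.sum_eq_zero fun K _ => ?_
      rw [D.macroValues_checker hπ, map_smul, macroForm_differenceTrial_of_interior hσ hπ hd1 h6
        (D.macroConforming_macroValues _ K) (D.macroValues_interior_fst w' K), smul_zero]
    have h12 := D.condensed_form hσ hc hab hab' hr M _ w 0 u v 0 (hext v)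
    have h11 := D.condensed_form hσ hc hab hab' hr M _ w u u 0 0 hY
    have h22 := D.condensed_form hσ hc hab hab' hr M _ (D.interiorField (-b / (2 * a)) v)
      0 0 v v (hext v)
    set B := D.condensed M (D.assemble (fun _ => r • blockPattern d a b c) (refine M))
    have hsub : ∀ K, macroForm a b σ D.axis
        (differenceTrial a b σ D.axis (D.pairSum v K) 0)
        (harmonicTrial a b σ D.axis (D.pairSum v K) 0) = macroForm a b σ D.axis
        (differenceTrial a b σ D.axis (D.pairSum v K) 0)
        (differenceTrial a b σ D.axis (D.pairSum v K) 0) := fun K =>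
      (macroForm_differenceTrial hσ hπ hd1 h6 (macroConforming_differenceTrial _ _)
        (zeroAggregates_differenceTrial hπ _ _) _ _).symm
    have e1 : D.meshForm a b σ M (D.hierField w u 0)
        (D.hierField (D.interiorField (-b / (2 * a)) v) 0 v) =
        D.meshForm a b σ M (D.hierField w u 0) (D.hierField w u 0) := by
      refine Finset.sum_congr rfl fun K _ => ?_
      rw [D.macroValues_checker hπ, D.macroValues_harmonic (σ := σ), pairDiff_checkerAggregates]
      simp only [map_smul, LinearMap.smul_apply, smul_eq_mul]
      rw [← hv, hsub]
    have e2 : D.meshForm a b σ M (D.hierField w u 0) (D.hierField w u 0) =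
        cbsSq d a b * D.meshForm a b σ M (D.hierField (D.interiorField (-b / (2 * a)) v) 0 v)
          (D.hierField (D.interiorField (-b / (2 * a)) v) 0 v) := by
      rw [meshForm, meshForm, Finset.mul_sum]
      refine Finset.sum_congr rfl fun K _ => ?_
      rw [D.macroValues_checker hπ, D.macroValues_harmonic (σ := σ), pairDiff_checkerAggregates]
      simp only [map_smul, LinearMap.smul_apply, smul_eq_mul]
      rw [macroForm_differenceTrial_self_eq hσ hπ hd1 h6 (by linarith)]
      ring
    have hpos : 0 < D.meshForm a b σ M (D.hierField (D.interiorField (-b / (2 * a)) v) 0 v)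
        (D.hierField (D.interiorField (-b / (2 * a)) v) 0 v) := by
      refine Finset.sum_pos (fun K _ => ?_) hM
      rw [D.macroValues_harmonic (σ := σ), pairDiff_checkerAggregates, map_smul, map_smul,
        LinearMap.smul_apply, macroForm_harmonic_harmonic hσ hπ ha]
      have h1 : ∀ i, D.pairSum v K i / 2 * D.pairSum v K i = 2 := by
        intro i
        rw [pairSum_checkerAggregates]
        linear_combination 2 * D.checkerSign_mul_self i K
      have h2 : (0 : ℝ) < d := by exact_mod_cast hd1
      have h3 : 0 < a - b := by linarith
      have h4 : 0 < a := by linarith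
      simp only [h1, Pi.zero_apply, zero_mul, add_zero, Finset.sum_const, Finset.card_univ,
        Fintype.card_fin, nsmul_eq_mul, smul_eq_mul]
      positivity
    have hg : 0 < cbsSq d a b := by
      have h1 : (0 : ℝ) < d - 1 := sub_pos.2 (by exact_mod_cast hd)
      have h2 : 0 < a - 6 := by linarith
      have h3 : 0 < a - b := by linarith
      unfold cbsSq
      positivity
    rw [hl] at h11 h12
    rw [hr'] at h22 h12
    rw [e1] at h12
    rw [e2] at h12 h11
    generalize D.meshForm a b σ M (D.hierField (D.interiorField (-b / (2 * a)) v) 0 v)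
          (D.hierField (D.interiorField (-b / (2 * a)) v) 0 v) = E at *
    -- With `E` the energy of the harmonic extension, the mixed and the difference energies are both
    -- `cbsSq * E`. Both vectors are nonzero because their energies are positive.
    refine ⟨fun q => u q, fun F => v F, fun h0 => ?_, fun h0 => ?_, ?_⟩
    · rw [h0, Sum.elim_zero_zero, zero_dotProduct] at h11
      exact absurd h11 (by positivity)
    · rw [h0, Sum.elim_zero_zero, zero_dotProduct] at h22
      exact absurd h22 (by positivity)
    · rw [h11, h12, h22]
      have : r * (cbsSq d a b * E) * (r * E) = cbsSq d a b * (r * E) ^ 2 := by ring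
      rw [this, Real.sqrt_mul hg.le, Real.sqrt_sq (by positivity), eq_div_iff (by positivity),
        ← mul_assoc, Real.mul_self_sqrt hg.le]
      ring
  · rintro _ ⟨u, v, -, -, rfl⟩
    -- The harmonic extension of arbitrary differences has no explicit form here; existence
    -- suffices, since the bound holds for all interior values.
    obtain ⟨w, hw⟩ := D.exists_harmonic hσ hc hab hab' M (extendZero u) 0
    have h12 := D.condensed_form hσ hc hab hab' hr M _ w 0 (extendZero u) (extendZero v) 0
      (hext (extendZero v))
    have h11 := D.condensed_form hσ hc hab hab' hr M w w (extendZero u) (extendZero u) 0 0 hw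
    have h22 := D.condensed_form hσ hc hab hab' hr M _
      (D.interiorField (-b / (2 * a)) (extendZero v)) 0 0 (extendZero v) (extendZero v)
      (hext (extendZero v))
    have h := D.meshForm_hier_le hσ hπ hd1 hab hab' M w (extendZero u) (extendZero v)
    rw [hl] at h11 h12
    rw [hr'] at h22 h12
    simp only [extendZero_coe] at h11 h12 h22
    rw [h11, h12, h22]
    refine div_le_of_le_mul₀ (Real.sqrt_nonneg _) (Real.sqrt_nonneg _) ?_
    rw [mul_mul_mul_comm, Real.sqrt_mul (mul_self_nonneg r), Real.sqrt_mul_self hr.le,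
      Real.sqrt_mul (hnn _), mul_left_comm]
    exact mul_le_mul_of_nonneg_left h hr.le

end Discretization

/-! ## Element matrices on the finest mesh -/

/-- The shape functions of a pair of opposite facets on the unit interval. -/
def unitShape (t : Fin 2) (y : ℝ) : ℝ := if t = 0 then 1 - y else y

/-- The slopes of the shape functions. -/
def unitSlope (t : Fin 2) : ℝ := if t = 0 then -1 else 1

theorem unitShape_eq (t : Fin 2) (y : ℝ) : unitShape t y = unitShape t 0 + unitSlope t * y := by
  fin_cases t <;> simp [unitShape, unitSlope]; ring

theorem integral_unitShape_mul (t r : Fin 2) :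
    ∫ y in (0 : ℝ)..1, unitShape t y * unitShape r y = if t = r then 1 / 3 else 1 / 6 := by
  have h : ∀ A B C : ℝ, ∫ y in (0 : ℝ)..1, (A + B * y + C * y ^ 2) = A + B / 2 + C / 3 := by
    intro A B C
    rw [intervalIntegral.integral_eq_sub_of_hasDerivAt
      (f := fun y => A * y + B / 2 * y ^ 2 + C / 3 * y ^ 3)]
    · ring
    · intro y _
      have := (((hasDerivAt_id y).const_mul A).add ((hasDerivAt_pow 2 y).const_mul (B / 2))).add
        ((hasDerivAt_pow 3 y).const_mul (C / 3))
      refine this.congr_deriv ?_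
      norm_num
      ring
    · exact Continuous.intervalIntegrable (by fun_prop) _ _
  have h2 := h (unitShape t 0 * unitShape r 0)
    (unitShape t 0 * unitSlope r + unitShape r 0 * unitSlope t) (unitSlope t * unitSlope r)
  rw [intervalIntegral.integral_congr (g := fun y => unitShape t 0 * unitShape r 0 +
    (unitShape t 0 * unitSlope r + unitShape r 0 * unitSlope t) * y +
      unitSlope t * unitSlope r * y ^ 2) fun y _ => ?_, h2]
  · fin_cases t <;> fin_cases r <;> norm_num [unitShape, unitSlope]
  · simp only
    rw [unitShape_eq t y, unitShape_eq r y]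
    ring

namespace Discretization

variable {d : ℕ} (D : Discretization d) {σ : Fin d → ℝ} {c : ℝ}

/-- The differential operator is a signed divergence: a field `u_i(x_(axis i)) e_i` with affine
`u_i` is mapped to `σ_i u_i'`. -/
structure IsSignedDivergence (σ : Fin d → ℝ) : Prop where
  h_pos : 0 < D.h
  axis_injective : Function.Injective D.axis
  sign_sq : ∀ i, σ i * σ i = 1
  X_affine : ∀ (u : VField d) (x : Fin d → ℝ) (i : Fin d) (A B : ℝ),
    u =ᶠ[nhds x] (fun y => Pi.single i (A + B * y (D.axis i))) → D.X u x = σ i * B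

/-- The interior of the cell `K`. -/
def openCell (K : Cell d) : Set (Fin d → ℝ) :=
  Set.univ.pi fun j => Set.Ioo (D.origin j + D.h * K j) (D.origin j + D.h * (K j + 1))

theorem isOpen_openCell (K : Cell d) : IsOpen (D.openCell K) :=
  isOpen_set_pi Set.finite_univ fun _ _ => isOpen_Ioo

theorem openCell_ae_eq (K : Cell d) : D.openCell K =ᵐ[volume] D.cell K := by
  have : D.cell K = Set.Icc (fun j => D.origin j + D.h * K j)
      (fun j => D.origin j + D.h * (K j + 1)) := by
    ext x
    simp only [cell, Set.mem_ofPred_eq, Set.mem_Icc, Pi.le_def]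
    exact forall_and
  rw [this, volume_pi]
  exact Measure.univ_pi_Ioo_ae_eq_Icc

theorem mem_openCell_iff (hh : 0 < D.h) (K : Cell d) (x : Fin d → ℝ) :
    x ∈ D.openCell K ↔ ∀ j, 0 < (x j - D.origin j) / D.h - K j ∧
      (x j - D.origin j) / D.h - K j < 1 := by
  simp only [openCell, Set.mem_univ_pi, Set.mem_Ioo]
  refine forall_congr' fun j => and_congr ?_ ?_
  · rw [sub_pos, lt_div_iff₀ hh]
    constructor <;> intro h <;> linarith
  · rw [sub_lt_iff_lt_add, div_lt_iff₀ hh]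
    constructor <;> intro h <;> linarith

theorem disjoint_openCell (hh : 0 < D.h) {K K' : Cell d} (h : K ≠ K') :
    Disjoint (D.openCell K) (D.openCell K') := by
  rw [Set.disjoint_left]
  intro x hx hx'
  rw [mem_openCell_iff D hh] at hx hx'
  refine h (funext fun j => ?_)
  have h1 := hx j
  have h2 := hx' j
  have h3 : (K j : ℝ) < K' j + 1 := by linarith [h1.1, h2.2]
  have h4 : (K' j : ℝ) < K j + 1 := by linarith [h1.2, h2.1]
  have h5 : K j < K' j + 1 := by exact_mod_cast h3
  have h6 : K' j < K j + 1 := by exact_mod_cast h4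
  omega

/-- Fubini: the integrand is a product of one-dimensional functions, constant in all directions but
`k`. -/
theorem integral_openCell (hh : 0 < D.h) (K : Cell d) (k : Fin d) (G : ℝ → ℝ) :
    ∫ x in D.openCell K, G ((x k - D.origin k) / D.h - K k) =
      D.h ^ d * ∫ y in (0 : ℝ)..1, G y := by
  set F : Fin d → ℝ → ℝ := fun j =>
    (Set.Ioo (D.origin j + D.h * K j) (D.origin j + D.h * (K j + 1))).indicator
      (fun y => (if j = k then G else fun _ => 1) ((y - D.origin j) / D.h - K j)) with hF
  have h1 : ∀ j, ∫ y, F j y = D.h * (if j = k then ∫ y in (0 : ℝ)..1, G y else 1) := by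
    intro j
    rw [hF, integral_indicator measurableSet_Ioo, ← integral_Ioc_eq_integral_Ioo,
      ← intervalIntegral.integral_of_le (by nlinarith)]
    have h2 : ∀ y, (y - D.origin j) / D.h - K j = y / D.h - (D.origin j / D.h + K j) := by
      intro y; ring
    simp only [h2]
    rw [intervalIntegral.integral_comp_div_sub _ hh.ne']
    have h3 : (D.origin j + D.h * K j) / D.h - (D.origin j / D.h + K j) = 0 := by
      field_simp; ring
    have h4 : (D.origin j + D.h * (K j + 1)) / D.h - (D.origin j / D.h + K j) = 1 := by
      field_simp; ring
    rw [h3, h4, smul_eq_mul]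
    split_ifs <;> simp
  rw [← integral_indicator (D.isOpen_openCell K).measurableSet]
  have h2 : (D.openCell K).indicator (fun x => G ((x k - D.origin k) / D.h - K k)) =
      fun x => ∏ j, F j (x j) := by
    funext x
    by_cases hx : x ∈ D.openCell K
    · rw [Set.indicator_of_mem hx, Finset.prod_eq_single k]
      · rw [hF]
        simp only
        rw [Set.indicator_of_mem (Set.mem_univ_pi.1 hx k)]
        simp
      · intro j _ hj
        rw [hF]
        simp only
        rw [Set.indicator_of_mem (Set.mem_univ_pi.1 hx j), if_neg hj]
      · intro h; exact absurd (Finset.mem_univ _) h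
    · rw [Set.indicator_of_notMem hx]
      rw [openCell, Set.mem_univ_pi, not_forall] at hx
      obtain ⟨j, hj⟩ := hx
      rw [Finset.prod_eq_zero (Finset.mem_univ j)]
      exact Set.indicator_of_notMem hj _
  rw [h2, integral_fintype_prod_volume_eq_prod]
  simp only [h1, Finset.prod_mul_distrib, Finset.prod_ite_eq', Finset.mem_univ, if_true,
    Finset.prod_const, Finset.card_univ, Fintype.card_fin]

theorem basisField_facetOf (hh : 0 < D.h) {K : Cell d} {x : Fin d → ℝ} (hx : x ∈ D.openCell K)
    (i : Fin d) (t : Fin 2) : D.basisField (D.facetOf K (i, t)) x = Pi.single i (1 / D.h ^ (d - 1) *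
      unitShape t ((x (D.axis i) - D.origin (D.axis i)) / D.h - K (D.axis i))) := by
  rw [mem_openCell_iff D hh] at hx
  have h1 : ∏ j ∈ Finset.univ.erase (D.axis i), Set.indicator (Set.Ico (0 : ℝ) 1)
      (fun _ => (1 : ℝ)) ((x j - D.origin j) / D.h - (D.facetOf K (i, t)).2 j) = 1 := by
    refine Finset.prod_eq_one fun j hj => ?_
    have hj' := Finset.ne_of_mem_erase hj
    refine Set.indicator_of_mem ?_ _
    simp only [facetOf, if_neg hj', add_zero]
    exact ⟨(hx j).1.le, (hx j).2⟩
  have h2 : hat ((x (D.axis i) - D.origin (D.axis i)) / D.h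
      - (D.facetOf K (i, t)).2 (D.axis i)) =
      unitShape t ((x (D.axis i) - D.origin (D.axis i)) / D.h - K (D.axis i)) := by
    obtain ⟨h3, h4⟩ := hx (D.axis i)
    simp only [facetOf, if_true, Int.cast_add]
    rw [← sub_sub]
    generalize (x (D.axis i) - D.origin (D.axis i)) / D.h - K (D.axis i) = y at *
    fin_cases t
    · simp [hat, unitShape, abs_of_pos h3, h4.le]
    · simp [hat, unitShape, abs_of_neg (sub_neg.2 h4), h3.le]
  refine congrArg (Pi.single i) ?_
  refine (congrArg _ h1).trans ?_
  rw [mul_one]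
  exact congrArg _ h2

theorem basisField_eq_zero (hh : 0 < D.h) {K : Cell d} {x : Fin d → ℝ} (hx : x ∈ D.openCell K)
    {f : Facet d} (hf : f ∉ D.facets {K}) : D.basisField f x = 0 := by
  rw [mem_openCell_iff D hh] at hx
  obtain ⟨i, n⟩ := f
  simp only [basisField]
  by_cases h : ∃ j, j ≠ D.axis i ∧ n j ≠ K j
  · obtain ⟨j, hj, hn⟩ := h
    rw [Finset.prod_eq_zero (Finset.mem_erase.2 ⟨hj, Finset.mem_univ j⟩), mul_zero, Pi.single_zero]
    refine Set.indicator_of_notMem (fun hm => hn ?_) _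
    obtain ⟨h1, h2⟩ := hm
    have h3 : (n j : ℝ) < K j + 1 := by linarith [(hx j).2]
    have h4 : (K j : ℝ) < n j + 1 := by linarith [(hx j).1]
    have h5 : n j < K j + 1 := by exact_mod_cast h3
    have h6 : K j < n j + 1 := by exact_mod_cast h4
    omega
  · push Not at h
    have hat0 : hat ((x (D.axis i) - D.origin (D.axis i)) / D.h - n (D.axis i)) = 0 := by
      obtain ⟨h1, h2⟩ := hx (D.axis i)
      -- The remaining values n = K and n = K + 1 are the two facets of the cell; otherwise the hat
      -- is supported off the open cell.
      have h3 : n (D.axis i) ≤ K (D.axis i) - 1 ∨ K (D.axis i) + 2 ≤ n (D.axis i) := by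
        by_contra hcon
        push Not at hcon
        refine hf (D.mem_facets.2 ⟨K, Finset.mem_singleton_self K, ?_⟩)
        rcases (by omega : n (D.axis i) = K (D.axis i) ∨ n (D.axis i) = K (D.axis i) + 1) with h3 | h3
        · refine ⟨(i, 0), ?_⟩
          simp only [facetOf, Prod.mk.injEq, true_and]
          funext j
          by_cases hj : j = D.axis i
          · subst hj; simp [h3]
          · simp [hj, h j hj]
        · refine ⟨(i, 1), ?_⟩
          simp only [facetOf, Prod.mk.injEq, true_and]
          funext j
          by_cases hj : j = D.axis i
          · subst hj; simp [h3]
          · simp [hj, h j hj]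
      refine max_eq_left ?_
      rw [sub_nonpos]
      rcases h3 with h3 | h3
      · have : (n (D.axis i) : ℝ) ≤ K (D.axis i) - 1 := by exact_mod_cast h3
        exact le_trans (by linarith) (le_abs_self _)
      · have : (K (D.axis i) : ℝ) + 2 ≤ n (D.axis i) := by exact_mod_cast h3
        exact le_trans (by linarith) (neg_le_abs _)
    rw [hat0, mul_zero, zero_mul, Pi.single_zero]

theorem basisField_affine (hh : 0 < D.h) (K : Cell d) (f : Facet d) :
    ∃ A B, ∀ x ∈ D.openCell K, D.basisField f x = Pi.single f.1 (A + B * x (D.axis f.1)) := by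
  by_cases hf : f ∈ D.facets {K}
  · obtain ⟨K', hK', ⟨i, t⟩, rfl⟩ := D.mem_facets.1 hf
    obtain rfl := Finset.mem_singleton.1 hK'
    refine ⟨1 / D.h ^ (d - 1) * (unitShape t 0 + unitSlope t *
      (-D.origin (D.axis i) / D.h - K' (D.axis i))), 1 / D.h ^ (d - 1) * (unitSlope t / D.h),
      fun x hx => ?_⟩
    rw [D.basisField_facetOf hh hx, unitShape_eq]
    refine congrArg (Pi.single i) ?_
    simp only [facetOf]
    ring
  · refine ⟨0, 0, fun x hx => ?_⟩
    rw [D.basisField_eq_zero hh hx hf]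
    simp

/-- The operator is a pointwise derivative, so it is evaluated on open cells, where the basis fields
are affine; their jumps sit on a null set. -/
theorem X_of_affine (hD : D.IsSignedDivergence σ) {K : Cell d} {x : Fin d → ℝ}
    (hx : x ∈ D.openCell K) {u : VField d} {i : Fin d} {A B : ℝ}
    (hu : ∀ x ∈ D.openCell K, u x = Pi.single i (A + B * x (D.axis i))) : D.X u x = σ i * B :=
  hD.X_affine u x i A B (Filter.eventually_of_mem ((D.isOpen_openCell K).mem_nhds hx) hu)

theorem integrableOn_openCell (K : Cell d) {F G : (Fin d → ℝ) → ℝ} (hG : Continuous G)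
    (h : ∀ x ∈ D.openCell K, F x = G x) : IntegrableOn F (D.openCell K) := by
  have h1 : IntegrableOn G (D.openCell K) :=
    (hG.integrableOn_Icc (a := fun j => D.origin j + D.h * K j)
      (b := fun j => D.origin j + D.h * (K j + 1))).mono_set fun x hx =>
        ⟨fun j => (Set.mem_univ_pi.1 hx j).1.le, fun j => (Set.mem_univ_pi.1 hx j).2.le⟩
  exact h1.congr_fun (fun x hx => (h x hx).symm) (D.isOpen_openCell K).measurableSet

theorem form_cell (K : Cell d) (u v : VField d) : D.form (D.cell K) u v =
    D.α * (∫ x in D.openCell K, u x ⬝ᵥ v x) + D.β * (∫ x in D.openCell K, D.X u x * D.X v x) := by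
  rw [form, setIntegral_congr_set (D.openCell_ae_eq K), setIntegral_congr_set (D.openCell_ae_eq K)]

theorem form_domain (hD : D.IsSignedDivergence σ) (M : Finset (Cell d)) (f g : Facet d) :
    D.form (D.domain M) (D.basisField f) (D.basisField g) =
      ∑ K ∈ M, D.form (D.cell K) (D.basisField f) (D.basisField g) := by
  have hdom : (⋃ K ∈ M, D.openCell K) =ᵐ[volume] D.domain M :=
    M.finite_toSet.eventuallyEq_iUnion fun K _ => D.openCell_ae_eq K
  have hdis : Set.Pairwise (M : Set (Cell d)) (Function.onFun Disjoint D.openCell) :=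
    fun K _ K' _ h => D.disjoint_openCell hD.h_pos h
  simp only [form_cell, Finset.sum_add_distrib, ← Finset.mul_sum]
  rw [form, ← setIntegral_congr_set hdom, ← setIntegral_congr_set hdom,
    integral_biUnion_finset M (fun K _ => (D.isOpen_openCell K).measurableSet) hdis,
    integral_biUnion_finset M (fun K _ => (D.isOpen_openCell K).measurableSet) hdis]
  · intro K _
    obtain ⟨A, B, h⟩ := D.basisField_affine hD.h_pos K f
    obtain ⟨A', B', h'⟩ := D.basisField_affine hD.h_pos K g
    refine D.integrableOn_openCell K (G := fun _ => σ f.1 * B * (σ g.1 * B')) (by fun_prop)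
      fun x hx => ?_
    rw [D.X_of_affine hD hx h, D.X_of_affine hD hx h']
  · intro K _
    obtain ⟨A, B, h⟩ := D.basisField_affine hD.h_pos K f
    obtain ⟨A', B', h'⟩ := D.basisField_affine hD.h_pos K g
    refine D.integrableOn_openCell K (G := fun x => if f.1 = g.1 then
      (A + B * x (D.axis f.1)) * (A' + B' * x (D.axis g.1)) else 0) ?_ fun x hx => ?_
    · split_ifs <;> fun_prop
    · rw [h x hx, h' x hx, single_dotProduct, Pi.single_apply]
      split_ifs <;> simp

/-- The mass integrals 1/3 and 1/6 and the slopes ±1, after extraction of β/(6 h^d), give 2e + 6 and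
e - 6. Different types are orthogonal in L² and couple only through `X`. -/
theorem form_cell_facetOf (hD : D.IsSignedDivergence σ) (hβ : D.β ≠ 0)
    (hc : ∀ i j, i ≠ j → c = 6 * σ i * σ j) (K : Cell d) (p q : Fin d × Fin 2) :
    D.form (D.cell K) (D.basisField (D.facetOf K p)) (D.basisField (D.facetOf K q)) =
      D.β / (6 * D.h ^ d) * blockPattern d (2 * (D.α / D.β * D.h ^ 2) + 6)
        (D.α / D.β * D.h ^ 2 - 6) c p q := by
  obtain ⟨i, t⟩ := p
  obtain ⟨j, r⟩ := q
  have hh := hD.h_pos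
  have hX : ∀ i t, ∀ x ∈ D.openCell K, D.X (D.basisField (D.facetOf K (i, t))) x =
      σ i * (1 / D.h ^ (d - 1) * (unitSlope t / D.h)) := by
    intro i t x hx
    refine D.X_of_affine hD hx (A := 1 / D.h ^ (d - 1) * (unitShape t 0 + unitSlope t *
      (-D.origin (D.axis i) / D.h - K (D.axis i)))) fun x hx => ?_
    rw [D.basisField_facetOf hh hx, unitShape_eq]
    refine congrArg (Pi.single i) ?_
    ring
  have h1 : ∫ x in D.openCell K, D.X (D.basisField (D.facetOf K (i, t))) x *
      D.X (D.basisField (D.facetOf K (j, r))) x =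
      D.h ^ d * (σ i * (1 / D.h ^ (d - 1) * (unitSlope t / D.h)) *
        (σ j * (1 / D.h ^ (d - 1) * (unitSlope r / D.h)))) := by
    refine (setIntegral_congr_fun (D.isOpen_openCell K).measurableSet fun x hx =>
      congrArg₂ (· * ·) (hX i t x hx) (hX j r x hx)).trans ?_
    rw [D.integral_openCell hh K i fun _ => σ i * (1 / D.h ^ (d - 1) * (unitSlope t / D.h)) *
        (σ j * (1 / D.h ^ (d - 1) * (unitSlope r / D.h)))]
    simp
  have h2 : ∫ x in D.openCell K, D.basisField (D.facetOf K (i, t)) x ⬝ᵥ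
      D.basisField (D.facetOf K (j, r)) x = if i = j then
      D.h ^ d * ((1 / D.h ^ (d - 1)) ^ 2 * if t = r then 1 / 3 else 1 / 6) else 0 := by
    by_cases hij : i = j
    · subst hij
      rw [if_pos rfl, ← integral_unitShape_mul, ← intervalIntegral.integral_const_mul,
        ← D.integral_openCell hh K (D.axis i)
          fun y => (1 / D.h ^ (d - 1)) ^ 2 * (unitShape t y * unitShape r y)]
      refine setIntegral_congr_fun (D.isOpen_openCell K).measurableSet fun x hx => ?_
      rw [D.basisField_facetOf hh hx, D.basisField_facetOf hh hx, single_dotProduct,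
        Pi.single_eq_same]
      ring
    · rw [if_neg hij]
      refine setIntegral_eq_zero_of_forall_eq_zero fun x hx => ?_
      rw [D.basisField_facetOf hh hx, D.basisField_facetOf hh hx, single_dotProduct,
        Pi.single_eq_of_ne hij, mul_zero]
  have hd : 1 ≤ d := i.pos
  have h3 : D.h ^ d = D.h * D.h ^ (d - 1) := by rw [← pow_succ', Nat.sub_add_cancel hd]
  have h4 : D.h ^ (d - 1) ≠ 0 := pow_ne_zero _ hh.ne'
  rw [form_cell, h1, h2, h3]
  generalize D.h ^ (d - 1) = H at *
  have h5 := hh.ne'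
  simp only [blockPattern]
  by_cases hij : i = j
  · subst hij
    have h6 := hD.sign_sq i
    rw [if_pos rfl, if_pos rfl]
    have h7 : D.h * H * (σ i * (1 / H * (unitSlope t / D.h)) *
        (σ i * (1 / H * (unitSlope r / D.h)))) = unitSlope t * unitSlope r / (D.h * H) := by
      field_simp
      linear_combination unitSlope t * unitSlope r * h6
    rw [h7]
    fin_cases t <;> fin_cases r <;> simp [unitSlope] <;> field_simp <;> ring
  · rw [if_neg hij, if_neg hij, hc i j hij]
    fin_cases t <;> fin_cases r <;> simp [unitSlope] <;> field_simp

theorem form_cell_eq_zero (hD : D.IsSignedDivergence σ) {K : Cell d} {f : Facet d}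
    (hf : f ∉ D.facets {K}) (g : Facet d) :
    D.form (D.cell K) (D.basisField f) (D.basisField g) = 0 ∧
      D.form (D.cell K) (D.basisField g) (D.basisField f) = 0 := by
  have h0 : ∀ x ∈ D.openCell K, D.basisField f x = 0 := fun x hx =>
    D.basisField_eq_zero hD.h_pos hx hf
  have hX : ∀ x ∈ D.openCell K, D.X (D.basisField f) x = 0 := fun x hx => by
    rw [D.X_of_affine hD hx (i := f.1) (A := 0) (B := 0) fun x hx => by simp [h0 x hx], mul_zero]
  have h (F : (Fin d → ℝ) → ℝ) (hF : ∀ x ∈ D.openCell K, F x = 0) :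
      ∫ x in D.openCell K, F x = 0 := setIntegral_eq_zero_of_forall_eq_zero hF
  constructor
  · rw [form_cell, h _ fun x hx => by simp [h0 x hx], h _ fun x hx => by simp [hX x hx]]
    simp
  · rw [form_cell, h _ fun x hx => by simp [h0 x hx], h _ fun x hx => by simp [hX x hx]]
    simp

theorem stiffness_zero (hD : D.IsSignedDivergence σ) (M : Finset (Cell d)) :
    D.stiffness 0 M = D.assemble (D.elementMatrix 0) M := by
  ext f g
  simp only [stiffness, assemble, elementMatrix]
  rw [D.form_domain hD]
  refine Finset.sum_congr rfl fun K _ => ?_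
  by_cases hf : (f : Facet d) ∈ D.facets {K}
  · by_cases hg : (g : Facet d) ∈ D.facets {K}
    · obtain ⟨K', hK', p, hp⟩ := D.mem_facets.1 hf
      obtain rfl := Finset.mem_singleton.1 hK'
      obtain ⟨K'', hK'', q, hq⟩ := D.mem_facets.1 hg
      obtain rfl := Finset.mem_singleton.1 hK''
      rw [Finset.sum_eq_single p, Finset.sum_eq_single q]
      · rw [if_pos ⟨hp, hq⟩, hp, hq]
      · intro q' _ hq'
        exact if_neg fun h => hq' (D.facetOf_injective _ (h.2.trans hq.symm))
      · intro h; exact absurd (Finset.mem_univ _) h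
      · intro p' _ hp'
        exact Finset.sum_eq_zero fun q' _ =>
          if_neg fun h => hp' (D.facetOf_injective _ (h.1.trans hp.symm))
      · intro h; exact absurd (Finset.mem_univ _) h
    · rw [(D.form_cell_eq_zero hD hg _).2]
      refine (Finset.sum_eq_zero fun p _ => Finset.sum_eq_zero fun q _ => if_neg fun h => hg ?_).symm
      rw [← h.2]
      exact D.facetOf_mem K q
  · rw [(D.form_cell_eq_zero hD hf _).1]
    refine (Finset.sum_eq_zero fun p _ => Finset.sum_eq_zero fun q _ => if_neg fun h => hf ?_).symm
    rw [← h.1]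
    exact D.facetOf_mem K p

end Discretization

/-! ## Monotonicity of the CBS constants -/

/-- A set of pairs that is invariant under the recursion and on which the constants decrease. -/
def DecreasingRegion (a b : ℝ) : Prop := (b ≤ 0 ∧ a * b ^ 2 ≤ 216) ∨ |b| ≤ a / 2

theorem sq_le_of_region {x y : ℝ} (hx : 1 < x) (h : x * y ^ 2 ≤ 1) : y ^ 2 ≤ 1 := by
  nlinarith [sq_nonneg y]

/-- The polynomial vanishes at (1, -1), the fixed point of the rescaled recursion, so the first
alternative needs an exact certificate. In the second, y ≥ -x/2 and y² ≤ x²/4 leave a positive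
remainder. -/
theorem planar_polynomial_pos {x y : ℝ} (hx : 1 < x)
    (h : (y ≤ 0 ∧ x * y ^ 2 ≤ 1) ∨ |y| ≤ x / 2) :
    0 < 3 * x ^ 4 + 2 * x ^ 3 * y - 5 * x ^ 2 * y ^ 2 + y ^ 4 + y ^ 2 - 2 * x * y := by
  have hx0 : 0 < x := by linarith
  rcases h with ⟨hy, h⟩ | h
  · have hy1 : 0 ≤ 1 + y := by nlinarith [sq_le_of_region hx h]
    have h1 : 0 ≤ (1 + y) * (2 * x * (x ^ 2 - 1)) := by
      have : 0 ≤ x ^ 2 - 1 := by nlinarith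
      positivity
    have h2 : 0 ≤ (1 - x * y ^ 2) * (5 * x ^ 3 - x - 1 - x * y ^ 2) := by
      refine mul_nonneg (by linarith) ?_
      nlinarith [mul_pos hx0 hx0, mul_pos hx0 (mul_pos hx0 hx0)]
    have h3 : 0 < (x - 1) ^ 2 * (3 * x ^ 4 + 4 * x ^ 3 + 5 * x ^ 2 + 3 * x + 1) := by
      have : 0 < x - 1 := by linarith
      positivity
    -- This is x² times the product in `h1` plus the products in `h2` and `h3`. The one in `h3`
    -- arises by setting y = -1 in the odd terms and x y² = 1 in the even ones.
    have h4 : 0 < x ^ 2 * (3 * x ^ 4 + 2 * x ^ 3 * y - 5 * x ^ 2 * y ^ 2 + y ^ 4 + y ^ 2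
        - 2 * x * y) := by
      have h5 : 0 ≤ x ^ 2 * ((1 + y) * (2 * x * (x ^ 2 - 1))) := by positivity
      linarith
    exact pos_of_mul_pos_right h4 (by positivity)
  · obtain ⟨h1, h2⟩ := abs_le.1 h
    have h3 : y ^ 2 ≤ x ^ 2 / 4 := by nlinarith
    have h4 : 0 ≤ (x / 2 + y) * (2 * x * (x ^ 2 - 1)) := by
      have : 0 ≤ x ^ 2 - 1 := by nlinarith
      have : 0 ≤ x / 2 + y := by linarith
      positivity
    have h5 : 0 ≤ (x ^ 2 / 4 - y ^ 2) * (5 * x ^ 2) := by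
      have : 0 ≤ x ^ 2 / 4 - y ^ 2 := by linarith
      positivity
    have h6 : 0 < x ^ 2 := by positivity
    have h7 : 0 < x ^ 4 := by positivity
    nlinarith [sq_nonneg (y ^ 2), sq_nonneg y]

/-- The certificate of the planar case, with the same substitutions, for the polynomial of d = 3. -/
theorem spatial_polynomial_pos {x y : ℝ} (hx : 1 < x)
    (h : (y ≤ 0 ∧ x * y ^ 2 ≤ 1) ∨ |y| ≤ x / 2) :
    0 < 3 * x ^ 4 + x ^ 3 + y ^ 4 - 5 * x ^ 2 * y ^ 2 - 2 * x * y ^ 2 + 2 * y ^ 2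
      + 2 * x * y * (x ^ 2 + x - 2) := by
  have hx0 : 0 < x := by linarith
  have hx2 : 0 ≤ x ^ 2 + x - 2 := by nlinarith
  rcases h with ⟨hy, h⟩ | h
  · have hy1 : 0 ≤ 1 + y := by nlinarith [sq_le_of_region hx h]
    have h2 : 0 ≤ (1 - x * y ^ 2) * (5 * x ^ 3 + 2 * x ^ 2 - 2 * x - 1 - x * y ^ 2) := by
      refine mul_nonneg (by linarith) ?_
      nlinarith [mul_pos hx0 hx0, mul_pos hx0 (mul_pos hx0 hx0)]
    have h3 : 0 < (x - 1) ^ 2 * (3 * x ^ 4 + 5 * x ^ 3 + 5 * x ^ 2 + 4 * x + 1) := by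
      have : 0 < x - 1 := by linarith
      positivity
    have h4 : 0 < x ^ 2 * (3 * x ^ 4 + x ^ 3 + y ^ 4 - 5 * x ^ 2 * y ^ 2 - 2 * x * y ^ 2
        + 2 * y ^ 2 + 2 * x * y * (x ^ 2 + x - 2)) := by
      have h5 : 0 ≤ x ^ 2 * ((1 + y) * (2 * x * (x ^ 2 + x - 2))) := by positivity
      linarith
    exact pos_of_mul_pos_right h4 (by positivity)
  · obtain ⟨h1, h2⟩ := abs_le.1 h
    have h3 : 0 ≤ x ^ 2 / 4 - y ^ 2 := by nlinarith
    have h4 : 0 ≤ (x / 2 + y) * (2 * x * (x ^ 2 + x - 2)) := by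
      have : 0 ≤ x / 2 + y := by linarith
      positivity
    have h5 : 0 ≤ (x ^ 2 / 4 - y ^ 2) * (5 * x ^ 2 + 2 * x) := by positivity
    have h6 : 0 < x ^ 2 := by positivity
    have h8 : 0 < x ^ 2 * (3 / 4 * x ^ 2 - 1 / 2 * x + 2) := by
      refine mul_pos h6 (by nlinarith)
    nlinarith [sq_nonneg (y ^ 2), sq_nonneg y]

theorem DecreasingRegion.scale {a b : ℝ} (h : DecreasingRegion a b) :
    (b / 6 ≤ 0 ∧ a / 6 * (b / 6) ^ 2 ≤ 1) ∨ |b / 6| ≤ a / 6 / 2 := by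
  rcases h with ⟨h1, h2⟩ | h
  · left
    constructor <;> nlinarith
  · right
    rw [abs_div, abs_of_pos (by norm_num : (0 : ℝ) < 6)]
    linarith

/-- After one step b is nonpositive. In the first alternative the new a b² is increasing in the old
b² and hence largest on the curve a b² = 216, which passes through the fixed point (6, -6). -/
theorem DecreasingRegion.next {a b : ℝ} (h6 : 6 < a) (h : DecreasingRegion a b) :
    DecreasingRegion (2 * a + -b ^ 2 / a) (-b ^ 2 / a) := by
  have ha : 0 < a := by linarith
  have hb' : -b ^ 2 / a ≤ 0 := div_nonpos_of_nonpos_of_nonneg (by nlinarith [sq_nonneg b]) ha.le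
  rcases h with ⟨h1, h2⟩ | h
  · left
    refine ⟨hb', ?_⟩
    have e : (2 * a + -b ^ 2 / a) * (-b ^ 2 / a) ^ 2 =
        (2 * a ^ 2 - b ^ 2) * (b ^ 2) ^ 2 / a ^ 3 := by
      field_simp
      ring
    rw [e, div_le_iff₀ (by positivity)]
    have hu : 0 ≤ b ^ 2 := sq_nonneg b
    generalize b ^ 2 = u at *
    have hu1 : u ≤ 216 / a := by rw [le_div_iff₀ ha]; linarith
    have hv : a * (216 / a) = 216 := by field_simp
    have hv0 : 0 < 216 / a := by positivity
    generalize 216 / a = v at *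
    have hva : v ≤ 36 := by nlinarith
    have h36 : 36 < a ^ 2 := by nlinarith
    -- Monotonicity in `u`, by factoring `v - u` out of the difference; it uses u ≤ v ≤ 36 < a².
    have k1 : (2 * a ^ 2 - u) * u ^ 2 ≤ (2 * a ^ 2 - v) * v ^ 2 := by
      have : 0 ≤ (v - u) * (2 * a ^ 2 * (v + u) - (v ^ 2 + v * u + u ^ 2)) := by
        refine mul_nonneg (by linarith) ?_
        nlinarith [mul_nonneg hv0.le hu, mul_nonneg hu (by linarith : 0 ≤ a ^ 2 - u),
          mul_nonneg hv0.le (by linarith : 0 ≤ a ^ 2 - v), mul_nonneg hv0.le (by linarith : 0 ≤ a ^ 2 - u)]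
      linarith
    refine k1.trans ?_
    -- At u = v, where a v = 216, the claim is exactly 216 times this square.
    have k2 : 0 ≤ (a ^ 3 - 216) ^ 2 := sq_nonneg _
    have k3 : a ^ 3 * ((2 * a ^ 2 - v) * v ^ 2) ≤ a ^ 3 * (216 * a ^ 3) := by
      have : a ^ 3 * ((2 * a ^ 2 - v) * v ^ 2) = 2 * a ^ 3 * (a * v) ^ 2 - (a * v) ^ 3 := by ring
      rw [this, hv]
      nlinarith
    exact le_of_mul_le_mul_left k3 (by positivity)
  · right
    rw [abs_of_nonpos hb']
    obtain ⟨h1, h2⟩ := abs_le.1 h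
    have h3 : b ^ 2 ≤ a ^ 2 / 4 := by nlinarith
    have h4 : b ^ 2 / a ≤ a / 4 := by
      rw [div_le_iff₀ ha]; nlinarith
    rw [neg_div]
    linarith

/-- With a' - b' = 2a, a' + b' = 2(a² - b²)/a and a a' = 2a² - b², clearing denominators and
dividing by a + b leaves (2a² - b²)² - 36a² > (a - b)²(a² - 36). This is the planar polynomial at
(a/6, b/6). -/
theorem cbsSq_two_lt {a b : ℝ} (h6 : 6 < a) (hab : 0 < a + b) (hab' : 0 < a - b)
    (h2 : 6 < 2 * a + -b ^ 2 / a) (h : DecreasingRegion a b) :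
    cbsSq 2 (2 * a + -b ^ 2 / a) (-b ^ 2 / a) < cbsSq 2 a b := by
  have ha : 0 < a := by linarith
  have ha6 : 0 < a - 6 := by linarith
  have e : (a * (2 * a + -b ^ 2 / a)) = 2 * a ^ 2 - b ^ 2 := by
    field_simp
    ring
  have hp := planar_polynomial_pos (by linarith : 1 < a / 6) h.scale
  have hq : 0 < 2 * a ^ 2 - b ^ 2 - 6 * a := by nlinarith
  have hq' : 0 < 2 * a ^ 2 - b ^ 2 + 6 * a := by linarith
  have e1 : cbsSq 2 (2 * a + -b ^ 2 / a) (-b ^ 2 / a) = 36 * (a + b) * (a - b) /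
      ((2 * a ^ 2 - b ^ 2 - 6 * a) * (2 * a ^ 2 - b ^ 2 + 6 * a)) := by
    have h1 : 2 * a + -b ^ 2 / a - 6 = (2 * a ^ 2 - b ^ 2 - 6 * a) / a := by
      field_simp
      ring
    have h3 : 2 * a + -b ^ 2 / a + 6 * (((2 : ℕ) : ℝ) - 1) = (2 * a ^ 2 - b ^ 2 + 6 * a) / a := by
      field_simp; norm_num; ring
    rw [cbsSq, h1, h3]
    field_simp
    norm_num
    ring
  have e2 : cbsSq 2 a b = 36 * (a + b) / ((a - 6) * (a + 6) * (a - b)) := by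
    rw [cbsSq]; norm_num
  rw [e1, e2, div_lt_div_iff₀ (by positivity) (by positivity)]
  have key : 0 < (2 * a ^ 2 - b ^ 2 - 6 * a) * (2 * a ^ 2 - b ^ 2 + 6 * a) -
      (a - b) ^ 2 * ((a - 6) * (a + 6)) := by nlinarith
  nlinarith [mul_pos hab key]

theorem cbsSq_three_lt {a b : ℝ} (h6 : 6 < a) (hab : 0 < a + b) (hab' : 0 < a - b)
    (h2 : 6 < 2 * a + -b ^ 2 / a) (h : DecreasingRegion a b) :
    cbsSq 3 (2 * a + -b ^ 2 / a) (-b ^ 2 / a) < cbsSq 3 a b := by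
  have ha : 0 < a := by linarith
  have ha6 : 0 < a - 6 := by linarith
  have e : (a * (2 * a + -b ^ 2 / a)) = 2 * a ^ 2 - b ^ 2 := by
    field_simp
    ring
  have hp := spatial_polynomial_pos (by linarith : 1 < a / 6) h.scale
  have hq : 0 < 2 * a ^ 2 - b ^ 2 - 6 * a := by nlinarith
  have hq' : 0 < 2 * a ^ 2 - b ^ 2 + 12 * a := by linarith
  have e1 : cbsSq 3 (2 * a + -b ^ 2 / a) (-b ^ 2 / a) = 72 * (a + b) * (a - b) /
      ((2 * a ^ 2 - b ^ 2 - 6 * a) * (2 * a ^ 2 - b ^ 2 + 12 * a)) := by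
    have h1 : 2 * a + -b ^ 2 / a - 6 = (2 * a ^ 2 - b ^ 2 - 6 * a) / a := by
      field_simp
      ring
    have h3 : 2 * a + -b ^ 2 / a + 6 * (((3 : ℕ) : ℝ) - 1) = (2 * a ^ 2 - b ^ 2 + 12 * a) / a := by
      field_simp; norm_num; ring
    rw [cbsSq, h1, h3]
    field_simp
    norm_num
    ring
  have e2 : cbsSq 3 a b = 72 * (a + b) / ((a - 6) * (a + 12) * (a - b)) := by
    rw [cbsSq]; norm_num
  rw [e1, e2, div_lt_div_iff₀ (by positivity) (by positivity)]
  have key : 0 < (2 * a ^ 2 - b ^ 2 - 6 * a) * (2 * a ^ 2 - b ^ 2 + 12 * a) -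
      (a - b) ^ 2 * ((a - 6) * (a + 12)) := by nlinarith
  nlinarith [mul_pos hab key]

/-! ### The recursion for a_k and b_k -/

theorem seqA_succ (e : ℝ) (k : ℕ) :
    seqA e (k + 1) = 2 * seqA e k + -seqB e k ^ 2 / seqA e k := rfl

theorem seqB_succ (e : ℝ) (k : ℕ) : seqB e (k + 1) = -seqB e k ^ 2 / seqA e k := rfl

/-- Both bounds propagate: a' - b' = 2a > 12, because 2a is the sum of a + b and a - b, and a' + b'
= 2(a + b)(a - b)/a > 0. -/
theorem seqAB_bounds {e : ℝ} (he : 0 < e) (k : ℕ) :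
    0 < seqA e k + seqB e k ∧ 12 < seqA e k - seqB e k := by
  induction k with
  | zero => simp only [seqA, seqB, seqAB]; constructor <;> linarith
  | succ k ih =>
    obtain ⟨h1, h2⟩ := ih
    rw [seqA_succ, seqB_succ]
    generalize seqA e k = a at *
    generalize seqB e k = b at *
    have ha : 0 < a := by linarith
    refine ⟨?_, by linarith⟩
    have : 2 * a + -b ^ 2 / a + -b ^ 2 / a = 2 * ((a + b) * (a - b)) / a := by field_simp; ring
    rw [this]
    have h3 : 0 < a - b := by linarith
    positivity

theorem six_lt_seqA {e : ℝ} (he : 0 < e) (k : ℕ) : 6 < seqA e k := by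
  have := seqAB_bounds he k; linarith [this.1, this.2]

theorem decreasingRegion_seq {e : ℝ} (he : 0 < e) (k : ℕ) :
    DecreasingRegion (seqA e k) (seqB e k) := by
  induction k with
  | zero =>
    simp only [seqA, seqB, seqAB]
    rcases le_or_gt e 6 with h | h
    · left
      refine ⟨by linarith, ?_⟩
      -- For the initial pair, 216 - a b² equals this product.
      have : 0 ≤ 2 * e ^ 2 * (9 - e) := by
        have : 0 ≤ 9 - e := by linarith
        positivity
      nlinarith
    · right
      rw [abs_of_pos (by linarith)]
      linarith
  | succ k ih =>
    rw [seqA_succ, seqB_succ]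
    exact ih.next (six_lt_seqA he k)

theorem cbsSq_two_seq_lt {e : ℝ} (he : 0 < e) (k : ℕ) :
    cbsSq 2 (seqA e (k + 1)) (seqB e (k + 1)) < cbsSq 2 (seqA e k) (seqB e k) :=
  cbsSq_two_lt (six_lt_seqA he k) (seqAB_bounds he k).1
    (lt_trans (by norm_num) (seqAB_bounds he k).2)
    (six_lt_seqA he (k + 1)) (decreasingRegion_seq he k)

theorem cbsSq_three_seq_lt {e : ℝ} (he : 0 < e) (k : ℕ) :
    cbsSq 3 (seqA e (k + 1)) (seqB e (k + 1)) < cbsSq 3 (seqA e k) (seqB e k) :=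
  cbsSq_three_lt (six_lt_seqA he k) (seqAB_bounds he k).1
    (lt_trans (by norm_num) (seqAB_bounds he k).2)
    (six_lt_seqA he (k + 1)) (decreasingRegion_seq he k)

/-- Without coarsening the common factor `e` cancels, and the value tends to 27/72 = 3/8 as e → 0.
Later values are smaller by monotonicity. -/
theorem cbsSq_two_seq_lt_bound {e : ℝ} (he : 0 < e) (k : ℕ) :
    cbsSq 2 (seqA e k) (seqB e k) < 3 / 8 := by
  induction k with
  | zero =>
    have : cbsSq 2 (seqA e 0) (seqB e 0) = 27 / ((e + 6) * (e + 12)) := by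
      simp only [cbsSq, seqA, seqB, seqAB]
      have h1 : 2 * e + 6 - (e - 6) = e + 12 := by ring
      have h2 : 2 * e + 6 - 6 = 2 * e := by ring
      rw [h1, h2]
      norm_num
      field_simp
      ring
    rw [this, div_lt_div_iff₀ (by positivity) (by positivity)]
    nlinarith
  | succ k ih => exact (cbsSq_two_seq_lt he k).trans ih

theorem cbsSq_three_seq_lt_bound {e : ℝ} (he : 0 < e) (k : ℕ) :
    cbsSq 3 (seqA e k) (seqB e k) < 1 / 2 := by
  induction k with
  | zero =>
    have : cbsSq 3 (seqA e 0) (seqB e 0) = 54 / ((e + 9) * (e + 12)) := by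
      simp only [cbsSq, seqA, seqB, seqAB]
      have h1 : 2 * e + 6 - (e - 6) = e + 12 := by ring
      have h2 : 2 * e + 6 - 6 = 2 * e := by ring
      rw [h1, h2]
      norm_num
      field_simp
      ring
    rw [this, div_lt_div_iff₀ (by positivity) (by positivity)]
    nlinarith
  | succ k ih => exact (cbsSq_three_seq_lt he k).trans ih

namespace Discretization

variable {d : ℕ} (D : Discretization d) {σ : Fin d → ℝ} {c e : ℝ}

/-! ## All levels of the recursive splitting -/

theorem assemble_singleton (P : Matrix (Fin d × Fin 2) (Fin d × Fin 2) ℝ) (K : Cell d)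
    (p q : Fin d × Fin 2) :
    D.assemble (fun _ => P) {K} ⟨D.facetOf K p, D.facetOf_mem K p⟩
      ⟨D.facetOf K q, D.facetOf_mem K q⟩ = P p q := by
  simp only [assemble, Finset.sum_singleton, (D.facetOf_injective K).eq_iff]
  rw [Finset.sum_eq_single p, Finset.sum_eq_single q]
  · simp
  · intro q' _ hq'
    exact if_neg fun h => hq' h.2
  · intro h; exact absurd (Finset.mem_univ _) h
  · intro p' _ hp'
    exact Finset.sum_eq_zero fun q' _ => if_neg fun h => hp' h.1
  · intro h; exact absurd (Finset.mem_univ _) h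

/-- Division by 2^d in a coarsening step is the effect of doubling the cell size. -/
theorem level_scale (β h : ℝ) (k : ℕ) :
    β / (6 * (2 ^ k * h) ^ d) / 2 ^ d = β / (6 * (2 ^ (k + 1) * h) ^ d) := by
  rw [div_div, pow_succ, mul_assoc, ← mul_pow]
  congr 3
  ring

theorem elementMatrix_eq (hD : D.IsSignedDivergence σ) (hc : ∀ i j, i ≠ j → c = 6 * σ i * σ j)
    (hd : 1 ≤ d) (hα : 0 < D.α) (hβ : 0 < D.β) (he : e = D.α / D.β * D.h ^ 2)
    (k : ℕ) (K : Cell d) : D.elementMatrix k K =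
      (D.β / (6 * (2 ^ k * D.h) ^ d)) • blockPattern d (seqA e k) (seqB e k) c := by
  have hh := hD.h_pos
  have he0 : 0 < e := by rw [he]; positivity
  induction k generalizing K with
  | zero =>
    ext p q
    refine (D.form_cell_facetOf hD hβ.ne' hc K p q).trans ?_
    rw [← he, pow_zero, one_mul]
    rfl
  | succ k ih =>
    ext p q
    rw [elementMatrix, funext ih, D.coarse_assemble hD.sign_sq hc hD.axis_injective hd
      (seqAB_bounds he0 k).1 (seqAB_bounds he0 k).2 (by positivity)]
    refine (D.assemble_singleton _ K p q).trans ?_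
    rw [level_scale]
    rfl

theorem stiffness_eq (hD : D.IsSignedDivergence σ) (hc : ∀ i j, i ≠ j → c = 6 * σ i * σ j)
    (hd : 1 ≤ d) (hα : 0 < D.α) (hβ : 0 < D.β) (he : e = D.α / D.β * D.h ^ 2)
    (k : ℕ) (M : Finset (Cell d)) : D.stiffness k M = D.assemble (fun _ =>
      (D.β / (6 * (2 ^ k * D.h) ^ d)) • blockPattern d (seqA e k) (seqB e k) c) M := by
  have hh := hD.h_pos
  have he0 : 0 < e := by rw [he]; positivity
  induction k generalizing M with
  | zero =>
    rw [D.stiffness_zero hD, funext (D.elementMatrix_eq hD hc hd hα hβ he 0)]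
  | succ k ih =>
    rw [stiffness, ih, D.coarse_assemble hD.sign_sq hc hD.axis_injective hd
      (seqAB_bounds he0 k).1 (seqAB_bounds he0 k).2 (by positivity), level_scale]
    rfl

theorem isGreatest_localQuotients (hD : D.IsSignedDivergence σ)
    (hc : ∀ i j, i ≠ j → c = 6 * σ i * σ j) (hd : 2 ≤ d) (hα : 0 < D.α) (hβ : 0 < D.β)
    (he : e = D.α / D.β * D.h ^ 2) (k : ℕ) (G : Cell d) :
    IsGreatest (D.localQuotients k G) √(cbsSq d (seqA e k) (seqB e k)) := by
  have hh := hD.h_pos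
  have he0 : 0 < e := by rw [he]; positivity
  rw [localQuotients, funext (D.elementMatrix_eq hD hc (by omega) hα hβ he k)]
  exact D.isGreatest_cbsQuotients hD.sign_sq hc hD.axis_injective hd (seqAB_bounds he0 k).1
    (seqAB_bounds he0 k).2 (by positivity) (Finset.singleton_nonempty G)

theorem macroElements_nonempty {M : Finset (Cell d)} (hM : M.Nonempty) (l : ℕ) :
    (macroElements M l).Nonempty := by
  rw [macroElements]
  induction l with
  | zero => exact hM
  | succ l ih =>
    rw [Function.iterate_succ_apply']
    obtain ⟨K, hK⟩ := ih
    exact ⟨_, childCell_mem_refine hK 0⟩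

theorem isGreatest_globalQuotients (hD : D.IsSignedDivergence σ)
    (hc : ∀ i j, i ≠ j → c = 6 * σ i * σ j) (hd : 2 ≤ d) (hα : 0 < D.α) (hβ : 0 < D.β)
    (he : e = D.α / D.β * D.h ^ 2) {M : Finset (Cell d)} (hM : M.Nonempty) (L l : ℕ) :
    IsGreatest (D.globalQuotients M L l) √(cbsSq d (seqA e (L - l)) (seqB e (L - l))) := by
  have hh := hD.h_pos
  have he0 : 0 < e := by rw [he]; positivity
  rw [globalQuotients, D.stiffness_eq hD hc (by omega) hα hβ he]
  exact D.isGreatest_cbsQuotients hD.sign_sq hc hD.axis_injective hd (seqAB_bounds he0 _).1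
    (seqAB_bounds he0 _).2 (by positivity) (macroElements_nonempty hM l)

/-- The properties of the local and global CBS constants, given the bound and the monotonicity of
the closed form. -/
theorem cbs_properties (hD : D.IsSignedDivergence σ) (hc : ∀ i j, i ≠ j → c = 6 * σ i * σ j)
    (hd : 2 ≤ d) (hα : 0 < D.α) (hβ : 0 < D.β) (he : e = D.α / D.β * D.h ^ 2) {Θ : ℝ}
    (hΘ : ∀ k, cbsSq d (seqA e k) (seqB e k) < Θ)
    (hlt : ∀ k, cbsSq d (seqA e (k + 1)) (seqB e (k + 1)) < cbsSq d (seqA e k) (seqB e k)) :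
    (∀ (k : ℕ) (G : Cell d), IsLUB (D.localQuotients k G) (D.localCBS k G) ∧
      D.localCBS k G = √(cbsSq d (seqA e k) (seqB e k)) ∧ D.localCBS k G < √Θ) ∧
    (∀ (k : ℕ) (G G' : Cell d), D.localCBS (k + 1) G' < D.localCBS k G) ∧
    (∀ M : Finset (Cell d), M.Nonempty → ∀ L : ℕ,
      (∀ l ≤ L, IsLUB (D.globalQuotients M L l) (D.globalCBS M L l) ∧
        D.globalCBS M L l < √Θ ∧
        ∀ G ∈ macroElements M l, D.globalCBS M L l ≤ D.localCBS (L - l) G) ∧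
      (∀ l < L, D.globalCBS M L l < D.globalCBS M L (l + 1))) := by
  have hh := hD.h_pos
  have he0 : 0 < e := by rw [he]; positivity
  have hnn : ∀ k, 0 ≤ cbsSq d (seqA e k) (seqB e k) := fun k =>
    cbsSq_nonneg (by omega) (six_lt_seqA he0 k) (seqAB_bounds he0 k).1
      (by have := (seqAB_bounds he0 k).2; linarith)
  have hloc := D.isGreatest_localQuotients hD hc hd hα hβ he
  have hglob := fun M hM => D.isGreatest_globalQuotients hD hc hd hα hβ he (M := M) hM
  have el : ∀ k G, D.localCBS k G = √(cbsSq d (seqA e k) (seqB e k)) := fun k G =>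
    (hloc k G).csSup_eq
  have eg : ∀ M, M.Nonempty → ∀ L l, D.globalCBS M L l =
      √(cbsSq d (seqA e (L - l)) (seqB e (L - l))) := fun M hM L l => (hglob M hM L l).csSup_eq
  refine ⟨fun k G => ⟨?_, el k G, ?_⟩, fun k G G' => ?_, fun M hM L => ⟨fun l _ => ⟨?_, ?_,
    fun G _ => ?_⟩, fun l hl => ?_⟩⟩
  · rw [el]; exact (hloc k G).isLUB
  · rw [el]; exact Real.sqrt_lt_sqrt (hnn k) (hΘ k)
  · rw [el, el]; exact Real.sqrt_lt_sqrt (hnn _) (hlt k)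
  · rw [eg M hM]; exact (hglob M hM L l).isLUB
  · rw [eg M hM]; exact Real.sqrt_lt_sqrt (hnn _) (hΘ _)
  · rw [eg M hM, el]
  · rw [eg M hM, eg M hM, show L - l = L - (l + 1) + 1 by omega]
    exact Real.sqrt_lt_sqrt (hnn _) (hlt _)

end Discretization

/-! ## The two model problems -/

theorem pderiv_of_affine {d : ℕ} {u : VField d} {x : Fin d → ℝ} {i k : Fin d} {A B : ℝ}
    (hu : u =ᶠ[nhds x] fun y => Pi.single i (A + B * y k)) (j m : Fin d) :
    pderiv u j m x = if m = i ∧ j = k then B else 0 := by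
  have h1 : HasFDerivAt (fun y : Fin d → ℝ => (A + B * y k) • (Pi.single i 1 : Fin d → ℝ))
      ((B • ContinuousLinearMap.proj (R := ℝ) (φ := fun _ : Fin d => ℝ) k).smulRight
        (Pi.single i 1 : Fin d → ℝ)) x :=
    ((((ContinuousLinearMap.proj (R := ℝ) (φ := fun _ : Fin d => ℝ) k).hasFDerivAt).const_mul
      B).const_add A).smul_const _
  have h2 : (fun y : Fin d → ℝ => (A + B * y k) • (Pi.single i 1 : Fin d → ℝ)) =
      fun y => Pi.single i (A + B * y k) := by
    funext y
    rw [← Pi.single_smul', smul_eq_mul, mul_one]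
  rw [pderiv, hu.fderiv_eq, ← h2, h1.fderiv]
  by_cases hm : m = i
  · subst hm
    by_cases hj : j = k
    · subst hj; simp
    · simp [hj, Ne.symm hj]
  · simp [hm]

/-- Edges of type 0 carry v₁ as a function of y, which enters the curl with a minus sign; edges of
type 1 carry v₂ as a function of x. The product of the signs makes c = -6. -/
theorem isSignedDivergence_nedelecCurl (α β : ℝ) {h : ℝ} (hh : 0 < h) (origin : Fin 2 → ℝ) :
    (nedelecCurl α β h origin).IsSignedDivergence ![-1, 1] where
  h_pos := hh
  axis_injective := by
    intro i j
    fin_cases i <;> fin_cases j <;> simp [nedelecCurl]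
  sign_sq i := by fin_cases i <;> norm_num
  X_affine u x i A B hu := by
    simp only [nedelecCurl, scalarCurl]
    rw [pderiv_of_affine hu, pderiv_of_affine hu]
    fin_cases i <;> simp [nedelecCurl]

theorem isSignedDivergence_rtnDiv (α β : ℝ) {h : ℝ} (hh : 0 < h) (origin : Fin 3 → ℝ) :
    (rtnDiv α β h origin).IsSignedDivergence 1 where
  h_pos := hh
  axis_injective := Function.injective_id
  sign_sq i := by simp
  X_affine u x i A B hu := by
    simp only [rtnDiv, divergence3]
    rw [pderiv_of_affine hu, pderiv_of_affine hu, pderiv_of_affine hu]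
    fin_cases i <;> simp [rtnDiv]

theorem cbsSq_two (a b : ℝ) : cbsSq 2 a b = 36 * (a + b) / ((a ^ 2 - 36) * (a - b)) := by
  rw [cbsSq]
  congr 1
  · norm_num
  · push_cast; ring

theorem cbsSq_three (a b : ℝ) :
    cbsSq 3 a b = 72 * (a + b) / ((a + 12) * (a - 6) * (a - b)) := by
  rw [cbsSq]
  congr 1
  · norm_num
  · push_cast; ring

end

theorem mainTheorem1 (α β h : ℝ) (hα : 0 < α) (hβ : 0 < β) (hh : 0 < h)
    (e : ℝ) (he : e = α / β * h ^ 2) :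
    -- two-dimensional `H(curl)`, Nedelec elements
    (∀ (origin : Fin 2 → ℝ) (D : Discretization 2), D = nedelecCurl α β h origin →
      -- element matrices after `k` coarsening steps
      (∀ (k : ℕ) (K : Cell 2), D.elementMatrix k K
        = (β / (6 * (2 ^ k * h) ^ 2)) • blockPattern 2 (seqA e k) (seqB e k) (-6)) ∧
      -- local CBS constants: existence, closed form, bound, monotonicity
      (∀ (k : ℕ) (G : Cell 2), IsLUB (D.localQuotients k G) (D.localCBS k G) ∧
        D.localCBS k G
          = √(36 * (seqA e k + seqB e k) / ((seqA e k ^ 2 - 36) * (seqA e k - seqB e k))) ∧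
        D.localCBS k G < √(3 / 8)) ∧
      (∀ (k : ℕ) (G G' : Cell 2), D.localCBS (k + 1) G' < D.localCBS k G) ∧
      -- global CBS constants at all levels `l = 0, …, L`
      (∀ M : Finset (Cell 2), M.Nonempty → ∀ L : ℕ,
        (∀ l ≤ L, IsLUB (D.globalQuotients M L l) (D.globalCBS M L l) ∧
          D.globalCBS M L l < √(3 / 8) ∧
          ∀ G ∈ Discretization.macroElements M l,
            D.globalCBS M L l ≤ D.localCBS (L - l) G) ∧
        (∀ l < L, D.globalCBS M L l < D.globalCBS M L (l + 1)))) ∧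
    -- three-dimensional `H(div)`, Raviart-Thomas-Nedelec elements
    (∀ (origin : Fin 3 → ℝ) (D : Discretization 3), D = rtnDiv α β h origin →
      (∀ (k : ℕ) (K : Cell 3), D.elementMatrix k K
        = (β / (6 * (2 ^ k * h) ^ 3)) • blockPattern 3 (seqA e k) (seqB e k) 6) ∧
      (∀ (k : ℕ) (G : Cell 3), IsLUB (D.localQuotients k G) (D.localCBS k G) ∧
        D.localCBS k G
          = √(72 * (seqA e k + seqB e k) / ((seqA e k + 12) * (seqA e k - 6) * (seqA e k - seqB e k))) ∧
        D.localCBS k G < √(1 / 2)) ∧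
      (∀ (k : ℕ) (G G' : Cell 3), D.localCBS (k + 1) G' < D.localCBS k G) ∧
      (∀ M : Finset (Cell 3), M.Nonempty → ∀ L : ℕ,
        (∀ l ≤ L, IsLUB (D.globalQuotients M L l) (D.globalCBS M L l) ∧
          D.globalCBS M L l < √(1 / 2) ∧
          ∀ G ∈ Discretization.macroElements M l,
            D.globalCBS M L l ≤ D.localCBS (L - l) G) ∧
        (∀ l < L, D.globalCBS M L l < D.globalCBS M L (l + 1)))) := by
  have he0 : 0 < e := by rw [he]; positivity
  constructor
  · rintro origin D rfl
    have hD := isSignedDivergence_nedelecCurl α β hh origin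
    have hc : ∀ i j : Fin 2, i ≠ j → (-6 : ℝ) = 6 * ![(-1 : ℝ), 1] i * ![(-1 : ℝ), 1] j := by
      intro i j hij
      fin_cases i <;> fin_cases j <;> simp_all
    have h := Discretization.cbs_properties _ hD hc le_rfl hα hβ he (cbsSq_two_seq_lt_bound he0)
      (cbsSq_two_seq_lt he0)
    simp only [cbsSq_two] at h
    exact ⟨Discretization.elementMatrix_eq _ hD hc one_le_two hα hβ he, h⟩
  · rintro origin D rfl
    have hD := isSignedDivergence_rtnDiv α β hh origin
    have hc : ∀ i j : Fin 3, i ≠ j →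
        (6 : ℝ) = 6 * (1 : Fin 3 → ℝ) i * (1 : Fin 3 → ℝ) j := by
      intro i j _
      simp
    have h := Discretization.cbs_properties _ hD hc (by norm_num) hα hβ he
      (cbsSq_three_seq_lt_bound he0) (cbsSq_three_seq_lt he0)
    simp only [cbsSq_three] at h
    exact ⟨Discretization.elementMatrix_eq _ hD hc (by norm_num) hα hβ he, h⟩
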